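/- **Setting.** A (strict) real Krein space is a real vector space $V=V_+\oplus V_-$ with an inner product $g$ such that $V_+\perp V_-$, $V_+$ is positive definite and complete, and $V_-$ is negative definite and complete; $[v]=0$ for $v\in V_+$ and $[v]=1$ for $0\neq v\in V_-$. An ON-basis of $V$ is an ON-basis of $V_+$ together with an ON-basis of $V_-$ (for $-g$). A finite dimensional Krein subspace is a finite dimensional $W=(W\cap V_+)\oplus(W\cap V_-)$. A subspace is hypermaximal neutral if it equals its own $g$-orthogonal companion. Isomorphisms of Krein spaces preserve $g$ and the decomposition. A *spacetime system* consists of oriented hypersurfaces and regions, with an orientation reversal $\Sigma\mapsto\overline\Sigma$ of hypersurfaces, a boundary $\partial M$ of each region, and notions of decomposition and of copy of a hypersurface, of disjoint union of regions, and of gluing a region $M$ with $\partial M=\Sigma_1\cup\Sigma\cup\overline{\Sigma'}$ ($\Sigma'$ a copy of $\Sigma$) to itself along $\Sigma,\overline{\Sigma'}$, giving a region $M_1$ with $\partial M_1=\Sigma_1$. A *classical free fermionic field theory* on it assigns: to each hypersurface a separable real Krein space $(L_\Sigma,g_\Sigma)$ with $L_{\overline\Sigma}$ identified with $L_\Sigma$,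 $g_{\overline\Sigma}=-g_\Sigma$, the positive and negative parts being exchanged, and copies having isomorphic spaces; to each decomposition $\Sigma=\Sigma_1\cup\dots\cup\Sigma_n$ an isomorphism of Krein spaces $L_\Sigma\cong L_{\Sigma_1}\oplus\dots\oplus L_{\Sigma_n}$; to each region $M$ a real vector space $L_M$ and a linear map $r_M:L_M\to L_{\partial M}$ with hypermaximal neutral image $L_{\tilde M}$, with $L_{M}= L_{M_1}\oplus L_{M_2}$ and $r_M=r_{M_1}+r_{M_2}$ for disjoint unions; for each gluing as above an injective linear map $L_{M_1}\hookrightarrow L_M$ whose image is the set of those solutions whose components in $L_\Sigma$ and $L_{\overline{\Sigma'}}\cong L_\Sigma$ agree, and whose composition with $r_M$ and the projection to $L_{\Sigma_1}$ is $r_{M_1}$. **Quantization.** $\mathcal D_\Sigma$ is the real Fock space over $L_\Sigma$: sequences $\sigma=(\sigma_n)_{n\ge0}$ of continuous completely antisymmetric $n$-linear forms $\sigma_n$ on $L_\Sigma$ with $\sum_n n!\sum_{i_1,\dots,i_n}\sigma_n(\zeta_{i_1},\dots,\zeta_{i_n})^2<\infty$ for an ON-basis $(\zeta_i)$ of $L_\Sigma$,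 a Krein space with inner product $\sum_n n!\sum_{i_1,\dots,i_n}(-1)^{[\zeta_{i_1}]+\dots+[\zeta_{i_n}]}\sigma'_n(\zeta_{i_1},\dots,\zeta_{i_n})\sigma_n(\zeta_{i_1},\dots,\zeta_{i_n})$. An element $\xi$ of $\mathcal D_\Sigma$ is identified with the element $(x_1,\dots,x_n)\mapsto\xi_n(x_n,\dots,x_1)$ of $\mathcal D_{\overline{\Sigma'}}$. For $\partial M=\Sigma_1\cup\Sigma\cup\overline{\Sigma'}$, $\tau^*(\sigma\otimes\xi\otimes\xi')$ is the antisymmetrized product of the pullbacks of the three forms along the projections of $L_{\partial M}$, where for $a,b$ of degrees $m,n$ the product is $$\frac1{(m+n)!}\sum_{\pi\in S_{m+n}}\operatorname{sgn}(\pi)\,a(v_{\pi(1)},\dots,v_{\pi(m)})\,b(v_{\pi(m+1)},\dots,v_{\pi(m+n)}).$$ Let $u_M$ be the unique linear involution of $L_{\partial M}$ that exchanges the positive and negative parts anti-isometrically and is the identity on $L_{\tilde M}$. The probability map $A_M$ vanishes in odd degree and is given on $\sigma$ of degree $2n$ by $$A_M(\sigma)=\frac{(2n)!}{2^n n!}(-1)^n\sum_{i_1,\dots,i_n}(-1)^{[\zeta_{i_1}]+\dots+[\zeta_{i_n}]}\sigma(\zeta_{i_1},\dots,\zeta_{i_n},u_M\zeta_{i_n},\dots,u_M\zeta_{i_1})$$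 for any ON-basis $(\zeta_i)$ of $L_{\partial M}$, its domain $\mathcal D^\circ_{\partial M}\subseteq\mathcal D_{\partial M}$ being the set of elements on which these sums converge and do not depend on the basis. Let $A_\Sigma$ be the directed set of finite dimensional Krein subspaces $L_{\Sigma,\alpha}$ of $L_\Sigma$ under inclusion, $Q_\alpha$ the orthogonal projector onto $L_{\Sigma,\alpha}$, $\mathcal D_{\Sigma,\alpha}=\{\sigma:\sigma_n=\sigma_n\circ Q_\alpha^{\otimes n}\ \forall n\}$, and $P_\alpha$ the orthogonal projector of $\mathcal D_\Sigma$ onto $\mathcal D_{\Sigma,\alpha}$. For $\gamma\in A_\Sigma$ put $$\hat c_\gamma=\sum_{i\in I}(-1)^{[\xi_i]}A_M\bigl(\tau^*(\mathbf 1\otimes P_\gamma\xi_i\otimes P_\gamma\xi_i)\bigr),$$ with $(\xi_i)_{i\in I}$ an ON-basis of $\mathcal D_\Sigma$. **Theorem.** Let $M$ be a region with $\partial M=\Sigma_1\cup\Sigma\cup\overline{\Sigma'}$, $\Sigma'$ a copy of $\Sigma$, and let the region $M_1$ with $\partial M_1=\Sigma_1$ be the gluing of $M$ to itself along $\Sigma,\overline{\Sigma'}$.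 1. For every $\gamma\in A_\Sigma$, the sum defining $\hat c_\gamma$ converges, to the same value for every ON-basis of $\mathcal D_\Sigma$. 2. Let $\alpha_1\in A_{\Sigma_1}$ and $\sigma\in\mathcal D_{\Sigma_1,\alpha_1}$. Then there is $\alpha\in A_\Sigma$ such that for all $\gamma\ge\alpha$ and all ON-bases $(\xi_i)_{i\in I}$ of $\mathcal D_\Sigma$ $$A_{M_1}(\sigma)\cdot\hat c_\gamma=\sum_{i\in I}(-1)^{[\xi_i]}A_M\bigl(\tau^*(\sigma\otimes P_\gamma\xi_i\otimes P_\gamma\xi_i)\bigr).$$ 3. In particular the renormalized composition axiom holds on the subspace $\bigcup_{\alpha_1}\mathcal D_{\Sigma_1,\alpha_1}$: this subspace is dense in $\mathcal D_{\Sigma_1}$ and lies in $\mathcal D^\circ_{\Sigma_1}$; the $\mathcal D_{\Sigma,\alpha}$ are finite dimensional Krein subspaces of $\mathcal D_\Sigma$, increasing in $\alpha$, with dense union; $\tau^*(\sigma\otimes\xi\otimes\xi')\in\mathcal D^\circ_{\partial M}$ for all $\sigma\in\bigcup_{\alpha_1}\mathcal D_{\Sigma_1,\alpha_1}$ and $\xi,\xi'\in\bigcup_\alpha\mathcal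 D_{\Sigma,\alpha}$; and for every ON-basis $(\xi_i)$ of $\mathcal D_\Sigma$ and every such $\sigma$ the sums below converge for all $\gamma$, and $$\varinjlim_{\gamma}\Bigl(A_{M_1}(\sigma)\,\hat c_\gamma-\sum_{i\in I}(-1)^{[\xi_i]}A_M\bigl(\tau^*(\sigma\otimes P_\gamma\xi_i\otimes P_\gamma\xi_i)\bigr)\Bigr)=0,$$ meaning that for every $\varepsilon>0$ there is $\beta\in A_\Sigma$ such that the expression has absolute value $<\varepsilon$ for all $\gamma\ge\beta$. -/

import Mathlib

/-- A (strict) real Krein space, presented by its canonical decomposition `V = V₊ ⊕ V₋`: a real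
Hilbert space with an isometric involution `sym`, equal to `1` on `V₊` and to `-1` on `V₋`.  The
indefinite inner product is `kreinForm x y = ⟪sym x, y⟫`; it is positive definite and complete on
`V₊`, negative definite and complete on `V₋`, and `V₊ ⊥ V₋`. -/
class KreinSpace (V : Type*) [NormedAddCommGroup V] [InnerProductSpace ℝ V] extends
    CompleteSpace V where
  sym : V →ₗᵢ[ℝ] V
  sym_sym : ∀ x, sym (sym x) = x

open KreinSpace in
/-- The indefinite inner product `g` of a Krein space. -/
noncomputable def kreinForm {V : Type*} [NormedAddCommGroup V] [InnerProductSpace ℝ V]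
    [KreinSpace V] (x y : V) : ℝ := inner ℝ (sym x) y

open Classical KreinSpace in
/-- The signature `[v]`: `0` for `v` in the positive part, `1` for `v ≠ 0` in the negative part. -/
noncomputable def sig {V : Type*} [NormedAddCommGroup V] [InnerProductSpace ℝ V]
    [KreinSpace V] (v : V) : ℕ := if sym v = v then 0 else 1

open KreinSpace in
/-- An ON-basis of a Krein space: an ON-basis of the positive part together with an ON-basis of the
negative part (the latter for minus the indefinite inner product). -/
structure IsONBasis {V ι : Type*} [NormedAddCommGroup V] [InnerProductSpace ℝ V]
    [KreinSpace V] (ζ : ι → V) : Prop where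
  orthonormal : Orthonormal ℝ ζ
  adapted : ∀ i, sym (ζ i) = ζ i ∨ sym (ζ i) = -ζ i
  dense_span : (Submodule.span ℝ (Set.range ζ)).topologicalClosure = ⊤

section KreinFacts

open KreinSpace

theorem inner_sym_left {V : Type*} [NormedAddCommGroup V] [InnerProductSpace ℝ V]
    [KreinSpace V] (x y : V) : inner ℝ (sym x) y = inner ℝ x (sym y) := by
  have h := (sym (V := V)).inner_map_map x (sym y)
  rwa [sym_sym] at h

theorem IsONBasis.sym_eq {V ι : Type*} [NormedAddCommGroup V] [InnerProductSpace ℝ V]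
    [KreinSpace V] {ζ : ι → V} (h : IsONBasis ζ) (i : ι) :
    sym (ζ i) = (-1 : ℝ) ^ sig (ζ i) • ζ i := by
  unfold sig
  split_ifs with h1
  · simpa using h1
  · simpa using (h.adapted i).resolve_left h1

theorem exists_isONBasis (V : Type*) [NormedAddCommGroup V] [InnerProductSpace ℝ V]
    [KreinSpace V] : ∃ s : Set V, IsONBasis ((↑) : s → V) := by
  let P : Submodule ℝ V := LinearMap.eqLocus (sym (V := V)).toLinearMap LinearMap.id
  let N : Submodule ℝ V := LinearMap.eqLocus (sym (V := V)).toLinearMap (-LinearMap.id)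
  have hP : ∀ x, x ∈ P ↔ sym x = x := fun x => by simp [P]
  have hN : ∀ x, x ∈ N ↔ sym x = -x := fun x => by simp [N]
  have cP : IsClosed (P : Set V) := by
    have : (P : Set V) = {x | sym x = x} := Set.ext hP
    rw [this]
    exact isClosed_eq (sym (V := V)).continuous continuous_id
  have cN : IsClosed (N : Set V) := by
    have : (N : Set V) = {x | sym x = -x} := Set.ext hN
    rw [this]
    exact isClosed_eq (sym (V := V)).continuous continuous_neg
  have : CompleteSpace P := cP.completeSpace_coe
  have : CompleteSpace N := cN.completeSpace_coe
  have hPN : ∀ x ∈ P, ∀ y ∈ N, inner ℝ x y = 0 := by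
    intro x hx y hy
    have h1 := inner_sym_left x y
    rw [(hP x).1 hx, (hN y).1 hy, inner_neg_right] at h1
    linarith
  obtain ⟨w, b, hb⟩ := exists_hilbertBasis ℝ P
  obtain ⟨w', b', hb'⟩ := exists_hilbertBasis ℝ N
  let f : w ⊕ w' → V := Sum.elim (fun i => ((b i : P) : V)) (fun i => ((b' i : N) : V))
  have hf : Orthonormal ℝ f := by
    have h1 : Orthonormal ℝ (fun i => ((b i : P) : V)) :=
      b.orthonormal.comp_linearIsometry P.subtypeₗᵢ
    have h2 : Orthonormal ℝ (fun i => ((b' i : N) : V)) :=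
      b'.orthonormal.comp_linearIsometry N.subtypeₗᵢ
    refine ⟨?_, ?_⟩
    · rintro (i | i)
      · exact h1.1 i
      · exact h2.1 i
    · rintro (i | i) (j | j) hij
      · exact h1.2 (fun h => hij (by rw [h]))
      · exact hPN _ (b i).2 _ (b' j).2
      · rw [real_inner_comm]; exact hPN _ (b j).2 _ (b' i).2
      · exact h2.2 (fun h => hij (by rw [h]))
  refine ⟨Set.range f, hf.toSubtypeRange, ?_, ?_⟩
  · rintro ⟨_, i, rfl⟩
    rcases i with i | i
    · exact Or.inl ((hP _).1 (b i).2)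
    · exact Or.inr ((hN _).1 (b' i).2)
  · rw [Subtype.range_coe, Submodule.topologicalClosure_eq_top_iff, Submodule.eq_bot_iff]
    intro x hx
    have hx' : ∀ i, inner ℝ (f i) x = 0 := fun i =>
      (Submodule.mem_orthogonal _ x).1 hx _ (Submodule.subset_span ⟨i, rfl⟩)
    have kP : x + sym x ∈ P := by rw [hP, map_add, sym_sym, add_comm]
    have kN : x - sym x ∈ N := by rw [hN, map_sub, sym_sym]; abel
    have zP : (⟨x + sym x, kP⟩ : P) = 0 := by
      apply b.repr.injective
      rw [map_zero]
      ext i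
      rw [b.repr_apply_apply, Submodule.coe_inner]
      have h1 := hx' (Sum.inl i)
      have h2 := inner_sym_left ((b i : P) : V) x
      rw [(hP _).1 (b i).2] at h2
      simp only [f, Sum.elim_inl] at h1
      simp [inner_add_right, ← h2, h1]
    have zN : (⟨x - sym x, kN⟩ : N) = 0 := by
      apply b'.repr.injective
      rw [map_zero]
      ext i
      rw [b'.repr_apply_apply, Submodule.coe_inner]
      have h1 := hx' (Sum.inr i)
      have h2 := inner_sym_left ((b' i : N) : V) x
      rw [(hN _).1 (b' i).2, inner_neg_left] at h2
      simp only [f, Sum.elim_inr] at h1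
      simp [inner_sub_right, ← h2, h1]
    have e1 : x + sym x = 0 := congrArg Subtype.val zP
    have e2 : x - sym x = 0 := congrArg Subtype.val zN
    have e3 : (2 : ℝ) • x = 0 := by
      rw [two_smul]
      calc x + x = (x + sym x) + (x - sym x) := by abel
        _ = 0 := by rw [e1, e2, add_zero]
    simpa using e3

end KreinFacts

/-- A hypermaximal neutral subspace: one that equals its own orthogonal companion with respect to
the indefinite inner product. -/
def IsHypermaximalNeutral {V : Type*} [NormedAddCommGroup V] [InnerProductSpace ℝ V]
    [KreinSpace V] (N : Submodule ℝ V) : Prop :=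
  ∀ x, x ∈ N ↔ ∀ y ∈ N, kreinForm x y = 0

open KreinSpace in
/-- A hypermaximal neutral subspace `N` determines a unique linear involution that exchanges the
positive and the negative part anti-isometrically and is the identity on `N`. -/
theorem existsUnique_reversal {V : Type*} [NormedAddCommGroup V] [InnerProductSpace ℝ V]
    [KreinSpace V] (N : Submodule ℝ V) (hN : IsHypermaximalNeutral N) :
    ∃! u : V →ₗ[ℝ] V, (∀ x, u (u x) = x) ∧
      ((∀ x, sym x = x → sym (u x) = -u x) ∧ (∀ x, sym x = -x → sym (u x) = u x) ∧
        ∀ x y, kreinForm (u x) (u y) = -kreinForm x y) ∧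
      ∀ x ∈ N, u x = x := by
  have cN : IsClosed (N : Set V) := by
    have : (N : Set V) = ⋂ y ∈ N, {x | kreinForm x y = 0} := by
      ext x; simpa using hN x
    rw [this]
    refine isClosed_biInter fun y _ => isClosed_eq ?_ continuous_const
    unfold kreinForm
    exact ((sym (V := V)).continuous).inner continuous_const
  have : CompleteSpace N := cN.completeSpace_coe
  have hperp : ∀ x, x ∈ Nᗮ ↔ sym x ∈ N := by
    intro x
    rw [Submodule.mem_orthogonal', hN]
    unfold kreinForm
    rw [sym_sym]
  have hcomm : ∀ x, N.reflection (sym x) = -sym (N.reflection x) := by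
    intro x
    obtain ⟨y, hy, z, hz, rfl⟩ := N.exists_add_mem_mem_orthogonal x
    have hy' : sym y ∈ Nᗮ := by rw [hperp, sym_sym]; exact hy
    have hz' := (hperp z).1 hz
    rw [map_add, map_add, map_add, map_add, Submodule.reflection_mem_subspace_eq_self hy,
      Submodule.reflection_mem_subspace_eq_self hz',
      Submodule.reflection_mem_subspace_orthogonalComplement_eq_neg hz,
      Submodule.reflection_mem_subspace_orthogonalComplement_eq_neg hy', map_neg]
    abel
  refine ⟨N.reflection.toLinearEquiv.toLinearMap, ⟨?_, ⟨?_, ?_, ?_⟩, ?_⟩, ?_⟩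
  · intro x; simp
  · intro x hx
    have := hcomm x
    rw [hx] at this
    exact neg_eq_iff_eq_neg.mp this.symm
  · intro x hx
    have := hcomm x
    rw [hx, map_neg, neg_inj] at this
    exact this.symm
  · intro x y
    have h1 := hcomm x
    have h2 : sym (N.reflection x) = -N.reflection (sym x) := by rw [h1, neg_neg]
    simp only [kreinForm, LinearEquiv.coe_coe, LinearIsometryEquiv.coe_toLinearEquiv]
    rw [h2, inner_neg_left, LinearIsometryEquiv.inner_map_map]
  · intro x hx; simpa using Submodule.reflection_mem_subspace_eq_self hx
  · rintro u ⟨-, ⟨h1, h2, -⟩, h4⟩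
    have hu : ∀ x, sym (u x) = -u (sym x) := by
      intro x
      have k1 := h1 (x + sym x) (by rw [map_add, sym_sym, add_comm])
      have k2 := h2 (x - sym x) (by rw [map_sub, sym_sym]; abel)
      simp only [map_add, map_sub] at k1 k2
      have k3 : (2 : ℝ) • sym (u x) = (2 : ℝ) • (-u (sym x)) := by
        rw [two_smul, two_smul]
        calc sym (u x) + sym (u x)
            = (sym (u x) + sym (u (sym x))) + (sym (u x) - sym (u (sym x))) := by abel
          _ = -u (sym x) + -u (sym x) := by rw [k1, k2]; abel
      exact smul_right_injective V (two_ne_zero' ℝ) k3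
    ext x
    obtain ⟨y, hy, z, hz, rfl⟩ := N.exists_add_mem_mem_orthogonal x
    have hz' := (hperp z).1 hz
    have e := hu (sym z)
    rw [sym_sym, h4 _ hz', sym_sym] at e
    simp only [map_add, LinearEquiv.coe_coe, LinearIsometryEquiv.coe_toLinearEquiv]
    rw [h4 _ hy, Submodule.reflection_mem_subspace_eq_self hy,
      Submodule.reflection_mem_subspace_orthogonalComplement_eq_neg hz]
    exact congrArg (y + ·) (eq_neg_of_add_eq_zero_left (by
      nth_rewrite 2 [e]; exact add_neg_cancel _))

/-- The involution `u` determined by a hypermaximal neutral subspace. -/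
noncomputable def reversal {V : Type*} [NormedAddCommGroup V] [InnerProductSpace ℝ V]
    [KreinSpace V] (N : Submodule ℝ V) (hN : IsHypermaximalNeutral N) : V →ₗ[ℝ] V :=
  (existsUnique_reversal N hN).choose

/-- Sequences of continuous completely antisymmetric `n`-linear forms on `V`, one for each degree
`n`. -/
abbrev FockSeq (V : Type*) [NormedAddCommGroup V] [InnerProductSpace ℝ V] : Type _ :=
  (n : ℕ) → V [⋀^Fin n]→L[ℝ] ℝ

/-- A chosen ON-basis of a Krein space, as a set of vectors. -/
noncomputable def onBasis (V : Type*) [NormedAddCommGroup V] [InnerProductSpace ℝ V]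
    [KreinSpace V] : Set V := (exists_isONBasis V).choose

theorem isONBasis_onBasis (V : Type*) [NormedAddCommGroup V] [InnerProductSpace ℝ V]
    [KreinSpace V] : IsONBasis ((↑) : onBasis V → V) := (exists_isONBasis V).choose_spec

/-- Indices `(n; i₁, …, iₙ)` of basis vectors. -/
abbrev FockIdx (V : Type*) [NormedAddCommGroup V] [InnerProductSpace ℝ V] [KreinSpace V] :
    Type _ := Σ n : ℕ, Fin n → onBasis V

/-- The coefficients `√(n!) σₙ(ζ_{i₁}, …, ζ_{iₙ})`. -/
noncomputable def fockCoord {V : Type*} [NormedAddCommGroup V] [InnerProductSpace ℝ V]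
    [KreinSpace V] (σ : FockSeq V) (p : FockIdx V) : ℝ :=
  √(p.1.factorial : ℝ) * σ p.1 (fun k => (p.2 k : V))

/-- The elements of finite norm: `∑ₙ n! ∑_{i₁, …, iₙ} σₙ(ζ_{i₁}, …, ζ_{iₙ})² < ∞`. -/
noncomputable def fockSubmodule (V : Type*) [NormedAddCommGroup V] [InnerProductSpace ℝ V]
    [KreinSpace V] : Submodule ℝ (FockSeq V) where
  carrier := {σ | Memℓp (fockCoord σ) 2}
  add_mem' := by
    intro a b ha hb
    have : fockCoord (a + b) = fockCoord a + fockCoord b := by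
      funext p; simp [fockCoord, mul_add]
    change Memℓp (fockCoord (a + b)) 2
    rw [this]; exact Memℓp.add ha hb
  zero_mem' := by
    have : fockCoord (0 : FockSeq V) = 0 := by funext p; simp [fockCoord]
    change Memℓp (fockCoord (0 : FockSeq V)) 2
    rw [this]; exact zero_memℓp
  smul_mem' := by
    intro c a ha
    have : fockCoord (c • a) = c • fockCoord a := by
      funext p; simp [fockCoord]; ring
    change Memℓp (fockCoord (c • a)) 2
    rw [this]; exact Memℓp.const_smul ha c

/-- The real Fock space `𝓕(V)` over the Krein space `V`: the completed direct sum over `n` of the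
spaces of continuous completely antisymmetric `n`-linear forms (of finite norm). -/
def Fock (V : Type*) [NormedAddCommGroup V] [InnerProductSpace ℝ V] [KreinSpace V] : Type _ :=
  fockSubmodule V

section FockSpace

variable {V : Type*} [NormedAddCommGroup V] [InnerProductSpace ℝ V] [KreinSpace V]

noncomputable instance Fock.instAddCommGroup : AddCommGroup (Fock V) :=
  inferInstanceAs (AddCommGroup (fockSubmodule V))

noncomputable instance Fock.instModule : Module ℝ (Fock V) :=
  inferInstanceAs (Module ℝ (fockSubmodule V))

/-- The sequence of antisymmetric forms underlying an element of the Fock space. -/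
noncomputable def Fock.seq : Fock V →ₗ[ℝ] FockSeq V := (fockSubmodule V).subtype

theorem Fock.seq_injective : Function.Injective (Fock.seq (V := V)) :=
  (fockSubmodule V).injective_subtype

theorem Fock.memℓp (σ : Fock V) : Memℓp (fockCoord σ.seq) 2 := Subtype.property (p := _) σ

/-- The isometric embedding of the Fock space into a space of square summable sequences. -/
noncomputable def Fock.coord : Fock V →ₗ[ℝ] lp (fun _ : FockIdx V => ℝ) 2 where
  toFun σ := ⟨fockCoord σ.seq, σ.memℓp⟩
  map_add' a b := by
    ext p; exact (by simp [fockCoord, mul_add] :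
      fockCoord (a + b).seq p = fockCoord a.seq p + fockCoord b.seq p)
  map_smul' c a := by
    ext p; exact (by simp [fockCoord]; ring :
      fockCoord (c • a).seq p = c * fockCoord a.seq p)

theorem Fock.coord_apply (σ : Fock V) (p : FockIdx V) : Fock.coord σ p = fockCoord σ.seq p := rfl

/-- Each antisymmetric form is bounded by its Hilbert-Schmidt norm. -/
theorem Fock.abs_seq_le (σ : Fock V) (n : ℕ) (x : Fin n → V) :
    |σ.seq n x| ≤ ‖Fock.coord σ‖ * ∏ k, ‖x k‖ := by
  classical
  have hb := isONBasis_onBasis V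
  let b : HilbertBasis (onBasis V) ℝ V := HilbertBasis.mk hb.orthonormal hb.dense_span.ge
  have hbv : ∀ i, b i = (i : V) := fun i => by simp [b]
  let T : Finset (onBasis V) → Fin n → V := fun s k => ∑ i ∈ s, inner ℝ (i : V) (x k) • (i : V)
  have hT : Filter.Tendsto T Filter.atTop (nhds x) := by
    rw [tendsto_pi_nhds]
    intro k
    have := b.hasSum_repr (x k)
    simp only [b.repr_apply_apply, hbv] at this
    exact this
  have hlim := ((σ.seq n).cont.tendsto x).comp hT
  refine le_of_tendsto (hlim.abs) (Filter.Eventually.of_forall fun s => ?_)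
  have hexp : σ.seq n (T s) = ∑ i ∈ Fintype.piFinset (fun _ : Fin n => s),
      (∏ k, inner ℝ (i k : V) (x k)) * σ.seq n (fun k => (i k : V)) := by
    have h1 := (σ.seq n).toMultilinearMap.map_sum_finset
      (fun k (i : onBasis V) => inner ℝ (i : V) (x k) • (i : V)) (fun _ => s)
    refine h1.trans (Finset.sum_congr rfl fun i _ => ?_)
    have h2 := (σ.seq n).toMultilinearMap.map_smul_univ
      (fun k => inner ℝ (i k : V) (x k)) (fun k => (i k : V))
    exact h2
  change |σ.seq n (T s)| ≤ _
  rw [hexp]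
  refine abs_le_of_sq_le_sq ?_ (by positivity)
  refine (Finset.sum_mul_sq_le_sq_mul_sq _ _ _).trans ?_
  rw [mul_pow, mul_comm]
  refine mul_le_mul ?_ ?_ (Finset.sum_nonneg fun _ _ => sq_nonneg _) (sq_nonneg _)
  · have h3 : ∀ i : Fin n → onBasis V, (σ.seq n fun k => (i k : V)) ^ 2 ≤
        ‖Fock.coord σ ⟨n, i⟩‖ ^ 2 := by
      intro i
      rw [Fock.coord_apply, fockCoord, Real.norm_eq_abs, sq_abs, mul_pow,
        Real.sq_sqrt (by positivity)]
      have : (1 : ℝ) ≤ (n.factorial : ℝ) := by exact_mod_cast n.factorial_pos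
      exact le_mul_of_one_le_left (sq_nonneg _) this
    refine (Finset.sum_le_sum fun i _ => h3 i).trans ?_
    have h4 := lp.sum_rpow_le_norm_rpow (p := 2) (by simp) (Fock.coord σ)
      ((Fintype.piFinset (fun _ : Fin n => s)).map
        ⟨fun i => (⟨n, i⟩ : FockIdx V), fun i j h => by simpa using h⟩)
    rw [Finset.sum_map] at h4
    simp only [ENNReal.toReal_ofNat, Real.rpow_ofNat] at h4
    exact h4
  · simp only [← Finset.prod_pow]
    rw [← Finset.prod_univ_sum (fun _ => s) (fun k (i : onBasis V) => inner ℝ (i : V) (x k) ^ 2)]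
    refine Finset.prod_le_prod (fun _ _ => Finset.sum_nonneg fun _ _ => sq_nonneg _) fun k _ => ?_
    have := hb.orthonormal.sum_inner_products_le (x k) (s := s)
    simpa [sq_abs] using this

theorem Fock.coord_injective : Function.Injective (Fock.coord (V := V)) := by
  rw [← LinearMap.ker_eq_bot, LinearMap.ker_eq_bot']
  intro σ h
  apply Fock.seq_injective
  rw [map_zero]
  funext n
  ext x
  have := Fock.abs_seq_le σ n x
  rw [h, norm_zero, zero_mul] at this
  simpa using this

noncomputable instance Fock.instNormedAddCommGroup : NormedAddCommGroup (Fock V) :=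
  NormedAddCommGroup.induced (Fock V) (lp (fun _ : FockIdx V => ℝ) 2) Fock.coord
    Fock.coord_injective

/-- The positive definite inner product `∑ₙ n! ∑ σ'ₙ(ζ_{i₁}, …, ζ_{iₙ}) σₙ(ζ_{i₁}, …, ζ_{iₙ})`. -/
noncomputable instance Fock.instInnerProductSpace : InnerProductSpace ℝ (Fock V) where
  norm_smul_le c σ := by
    change ‖Fock.coord (c • σ)‖ ≤ ‖c‖ * ‖Fock.coord σ‖
    rw [map_smul, norm_smul]
  inner σ' σ := inner ℝ (Fock.coord σ') (Fock.coord σ)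
  norm_sq_eq_re_inner σ := norm_sq_eq_re_inner (𝕜 := ℝ) (Fock.coord σ)
  conj_inner_symm σ' σ := inner_conj_symm (𝕜 := ℝ) (Fock.coord σ') (Fock.coord σ)
  add_left a b c := by
    change inner ℝ (Fock.coord (a + b)) _ = _
    rw [map_add, inner_add_left]
  smul_left a b r := by
    change inner ℝ (Fock.coord (r • a)) _ = _
    rw [map_smul, inner_smul_left]

theorem Fock.norm_eq (σ : Fock V) : ‖σ‖ = ‖Fock.coord σ‖ := rfl

theorem Fock.inner_eq (σ' σ : Fock V) :
    inner ℝ σ' σ = inner ℝ (Fock.coord σ') (Fock.coord σ) := rfl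

instance Fock.instCompleteSpace : CompleteSpace (Fock V) := by
  refine Metric.complete_of_cauchySeq_tendsto fun s hs => ?_
  have hd : ∀ a b : Fock V, dist (Fock.coord a) (Fock.coord b) = dist a b := by
    intro a b
    rw [dist_eq_norm, dist_eq_norm, ← map_sub, Fock.norm_eq]
  have hc : CauchySeq fun k => Fock.coord (s k) := by
    rw [Metric.cauchySeq_iff] at hs ⊢
    simpa only [hd] using hs
  obtain ⟨a, ha⟩ := cauchySeq_tendsto_of_complete hc
  have hn : ∀ n, ∃ t : V [⋀^Fin n]→L[ℝ] ℝ,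
      Filter.Tendsto (fun k => (s k).seq n) Filter.atTop (nhds t) := by
    intro n
    apply cauchySeq_tendsto_of_complete
    rw [Metric.cauchySeq_iff] at hs ⊢
    intro ε hε
    obtain ⟨K, hK⟩ := hs ε hε
    refine ⟨K, fun m hm k hk => lt_of_le_of_lt ?_ (hK m hm k hk)⟩
    rw [dist_eq_norm, dist_eq_norm]
    refine ContinuousAlternatingMap.opNorm_le_bound _ (norm_nonneg _) fun x => ?_
    have := Fock.abs_seq_le (s m - s k) n x
    rw [map_sub] at this
    exact this
  choose t ht using hn
  have hcoord : fockCoord t = a := by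
    funext p
    have h1 : Filter.Tendsto (fun k => fockCoord (s k).seq p) Filter.atTop
        (nhds (fockCoord t p)) := by
      refine Filter.Tendsto.const_mul _ ?_
      have := (ContinuousEval.continuous_eval (F := V [⋀^Fin p.1]→L[ℝ] ℝ)).tendsto
        (t p.1, fun k => (p.2 k : V))
      exact this.comp ((ht p.1).prodMk_nhds tendsto_const_nhds)
    have h2 : Filter.Tendsto (fun k => Fock.coord (s k) p) Filter.atTop (nhds (a p)) := by
      rw [tendsto_iff_norm_sub_tendsto_zero] at ha ⊢
      refine squeeze_zero (fun _ => norm_nonneg _) (fun k => ?_) ha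
      exact lp.norm_apply_le_norm (by simp) (Fock.coord (s k) - a) p
    exact tendsto_nhds_unique h1 h2
  have hmem : t ∈ fockSubmodule V := by
    change Memℓp (fockCoord t) 2
    rw [hcoord]; exact a.2
  let τ : Fock V := ⟨t, hmem⟩
  have hτ : Fock.coord τ = a := by
    ext p; exact congrFun hcoord p
  refine ⟨τ, ?_⟩
  rw [tendsto_iff_dist_tendsto_zero] at ha ⊢
  simpa only [← hτ, hd] using ha

/-- The degree-wise pullback of antisymmetric forms along a continuous linear map. -/
noncomputable def FockSeq.pullback {V W : Type*} [NormedAddCommGroup V] [InnerProductSpace ℝ V]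
    [NormedAddCommGroup W] [InnerProductSpace ℝ W] (f : V →L[ℝ] W) (σ : FockSeq W) : FockSeq V :=
  fun n => (σ n).compContinuousLinearMap f

open KreinSpace in
theorem fockCoord_pullback_sym (σ : FockSeq V) (p : FockIdx V) :
    fockCoord (FockSeq.pullback (sym (V := V)).toContinuousLinearMap σ) p =
      (-1) ^ (∑ k, sig (p.2 k : V)) * fockCoord σ p := by
  have h : (fun k => sym (p.2 k : V)) =
      fun k => (-1 : ℝ) ^ sig (p.2 k : V) • (p.2 k : V) :=
    funext fun k => (isONBasis_onBasis V).sym_eq (p.2 k)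
  have h2 := (σ p.1).toMultilinearMap.map_smul_univ
    (fun k => (-1 : ℝ) ^ sig (p.2 k : V)) (fun k => (p.2 k : V))
  have h3 : FockSeq.pullback (sym (V := V)).toContinuousLinearMap σ p.1 (fun k => (p.2 k : V)) =
      (∏ k, (-1 : ℝ) ^ sig (p.2 k : V)) * σ p.1 (fun k => (p.2 k : V)) := by
    change σ p.1 (fun k => sym (p.2 k : V)) = _
    rw [h]; exact h2
  rw [fockCoord, fockCoord, h3, Finset.prod_pow_eq_pow_sum]
  ring

open KreinSpace in
/-- The Krein space structure of the Fock space, induced from that of `V`. -/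
noncomputable instance Fock.instKreinSpace : KreinSpace (Fock V) where
  sym :=
    { toFun := fun σ => ⟨FockSeq.pullback (sym (V := V)).toContinuousLinearMap σ.seq, by
        exact σ.memℓp.mono' fun p => by
          rw [fockCoord_pullback_sym, norm_mul, norm_pow, norm_neg, norm_one, one_pow, one_mul]⟩
      map_add' := fun a b => rfl
      map_smul' := fun c a => rfl
      norm_map' := fun σ => by
        refine (sq_eq_sq₀ (norm_nonneg _) (norm_nonneg _)).1 ?_
        have h := lp.norm_rpow_eq_tsum (p := 2) (E := fun _ : FockIdx V => ℝ) (by simp)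
        simp only [ENNReal.toReal_ofNat, Real.rpow_ofNat] at h
        rw [Fock.norm_eq, Fock.norm_eq, h, h]
        refine tsum_congr fun p => ?_
        change ‖fockCoord (FockSeq.pullback (sym (V := V)).toContinuousLinearMap σ.seq) p‖ ^ 2 =
          ‖fockCoord σ.seq p‖ ^ 2
        rw [fockCoord_pullback_sym, norm_mul, norm_pow, norm_neg, norm_one, one_pow, one_mul] }
  sym_sym σ := by
    apply Fock.seq_injective
    funext n; ext x
    change σ.seq n (fun k => sym (sym (x k))) = _
    simp only [sym_sym]

/-- The indefinite inner product of the Fock space: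
`∑ₙ n! ∑ (-1)^([ζ_{i₁}] + ⋯ + [ζ_{iₙ}]) σ'ₙ(ζ_{i₁}, …, ζ_{iₙ}) σₙ(ζ_{i₁}, …, ζ_{iₙ})`. -/
theorem Fock.kreinForm_eq (σ' σ : Fock V) :
    HasSum (fun p : FockIdx V => (p.1.factorial : ℝ) * ((-1) ^ (∑ k, sig (p.2 k : V)) *
      (σ'.seq p.1 fun k => (p.2 k : V)) * (σ.seq p.1 fun k => (p.2 k : V))))
      (kreinForm σ' σ) := by
  have h := lp.hasSum_inner (𝕜 := ℝ) (Fock.coord (KreinSpace.sym σ')) (Fock.coord σ)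
  refine h.congr_fun fun p => ?_
  have h2 : Fock.coord (KreinSpace.sym σ') p =
      (-1) ^ (∑ k, sig (p.2 k : V)) * fockCoord σ'.seq p := fockCoord_pullback_sym σ'.seq p
  rw [h2, Fock.coord_apply, fockCoord, fockCoord]
  simp only [RCLike.inner_apply, conj_trivial]
  have h3 : (p.1.factorial : ℝ) = √(p.1.factorial : ℝ) * √(p.1.factorial : ℝ) :=
    (Real.mul_self_sqrt (by positivity)).symm
  generalize √(p.1.factorial : ℝ) = q at h3 ⊢
  rw [h3]; ring

end FockSpace

section FockOperations

variable {V : Type*} [NormedAddCommGroup V] [InnerProductSpace ℝ V]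

/-- The splitting of `k` arguments into the first `m` and the remaining `k - m` ones. -/
def splitEquiv (k : ℕ) (m : Fin (k + 1)) : Fin (m : ℕ) ⊕ Fin (k - m) ≃ Fin k :=
  finSumFinEquiv.trans (finCongr (by omega))

/-- The form `(v₁, …, v_k) ↦ f (v₁, …, v_m) * g (v_{m+1}, …, v_k)`. -/
noncomputable def tensorForm {k : ℕ} (m : Fin (k + 1)) (f : V [⋀^Fin (m : ℕ)]→L[ℝ] ℝ)
    (g : V [⋀^Fin (k - m)]→L[ℝ] ℝ) : ContinuousMultilinearMap ℝ (fun _ : Fin k => V) ℝ where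
  toMultilinearMap :=
    ((LinearMap.mul' ℝ ℝ).compMultilinearMap
      (f.toMultilinearMap.domCoprod g.toMultilinearMap)).domDomCongr (splitEquiv k m)
  cont := by
    change Continuous fun v : Fin k → V =>
      f (fun i => v (splitEquiv k m (Sum.inl i))) * g (fun j => v (splitEquiv k m (Sum.inr j)))
    exact (f.cont.comp (by fun_prop)).mul (g.cont.comp (by fun_prop))

/-- The antisymmetrized product: for `a` of degree `m` and `b` of degree `n`,
`(a ∧ b)(v₁, …, v_{m+n}) = 1/(m+n)! ∑_τ sign τ a(v_{τ1}, …, v_{τm}) b(v_{τ(m+1)}, …, v_{τ(m+n)})`,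
extended bilinearly to sequences of forms. -/
noncomputable def FockSeq.wedge (a b : FockSeq V) : FockSeq V := fun k =>
  ∑ m : Fin (k + 1), ((k.factorial : ℝ)⁻¹) •
    ContinuousMultilinearMap.alternatization (tensorForm m (a m) (b (k - m)))

theorem FockSeq.wedge_apply (a b : FockSeq V) (k : ℕ) (v : Fin k → V) :
    FockSeq.wedge a b k v = ∑ m : Fin (k + 1), (k.factorial : ℝ)⁻¹ *
      ∑ τ : Equiv.Perm (Fin k), ((Equiv.Perm.sign τ : ℤ) : ℝ) *
        (a m (fun i => v (τ ⟨i, by omega⟩)) * b (k - m) (fun j => v (τ ⟨m + j, by omega⟩))) := by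
  rw [FockSeq.wedge, ContinuousAlternatingMap.sum_apply]
  refine Finset.sum_congr rfl fun m _ => ?_
  rw [ContinuousAlternatingMap.smul_apply, ContinuousMultilinearMap.alternatization_apply_apply,
    smul_eq_mul]
  refine congrArg _ (Finset.sum_congr rfl fun τ _ => ?_)
  rw [Units.smul_def, zsmul_eq_mul]
  rfl

/-- Reversal of the order of the arguments in every degree. -/
noncomputable def FockSeq.reverse (a : FockSeq V) : FockSeq V := fun n =>
  { (a n).toContinuousMultilinearMap.domDomCongr Fin.revPerm with
    map_eq_zero_of_eq' := fun v i j h hij =>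
      (a n).map_eq_zero_of_eq (fun k => v (Fin.revPerm k)) (i := Fin.revPerm i)
        (j := Fin.revPerm j) (by simpa using h) (fun e => hij (Fin.revPerm.injective e)) }

theorem FockSeq.reverse_apply (a : FockSeq V) (n : ℕ) (v : Fin n → V) :
    FockSeq.reverse a n v = a n (fun k => v (Fin.rev k)) := rfl

/-- The element `𝟏` of degree zero. -/
noncomputable def FockSeq.one : FockSeq V
  | 0 => ContinuousAlternatingMap.constOfIsEmpty ℝ V (Fin 0) 1
  | _ + 1 => 0

end FockOperations

section Truncation

variable {V : Type*} [NormedAddCommGroup V] [InnerProductSpace ℝ V] [KreinSpace V]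

/-- The element `𝟏` of the Fock space. -/
noncomputable def Fock.one : Fock V := ⟨FockSeq.one, by
  change Memℓp (fockCoord (FockSeq.one (V := V))) 2
  refine Memℓp.of_exponent_ge (q := 0) (memℓp_zero ?_) zero_le
  refine (Set.finite_singleton (⟨0, fun k => k.elim0⟩ : FockIdx V)).subset ?_
  rintro ⟨n, i⟩ h
  rcases n with _ | n
  · simp only [Set.mem_singleton_iff, Sigma.mk.injEq, heq_eq_eq, true_and]
    exact Subsingleton.elim _ _
  · exact absurd (by simp [fockCoord, FockSeq.one]) h⟩

variable (V) in
/-- The direct system of all finite dimensional Krein subspaces `W = (W ∩ V₊) ⊕ (W ∩ V₋)` of `V`,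
ordered by inclusion. -/
abbrev FinKrein : Type _ :=
  {W : Submodule ℝ V // FiniteDimensional ℝ W ∧ ∀ x ∈ W, KreinSpace.sym x ∈ W}

/-- The orthogonal projector `Q_α` onto a finite dimensional Krein subspace. -/
noncomputable def FinKrein.proj (α : FinKrein V) : V →L[ℝ] V :=
  haveI := α.2.1
  α.1.starProjection

/-- The subspace `𝓕(V)_α` of those `σ` with `σ = σ ∘ Q_α^{⊗ n}` in every degree `n`. -/
noncomputable def truncation (α : FinKrein V) : Submodule ℝ (Fock V) where
  carrier := {σ | FockSeq.pullback α.proj σ.seq = σ.seq}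
  add_mem' {a b} ha hb := by
    change FockSeq.pullback α.proj a.seq + FockSeq.pullback α.proj b.seq = a.seq + b.seq
    exact congrArg₂ (· + ·) ha hb
  zero_mem' := rfl
  smul_mem' c a ha := by
    change c • FockSeq.pullback α.proj a.seq = c • a.seq
    exact congrArg (c • ·) ha

theorem Fock.continuous_apply (n : ℕ) (x : Fin n → V) :
    Continuous fun σ : Fock V => σ.seq n x := by
  let f : Fock V →ₗ[ℝ] ℝ :=
    { toFun := fun σ => σ.seq n x
      map_add' := fun a b => rfl
      map_smul' := fun c a => rfl }
  exact (f.mkContinuous (∏ k, ‖x k‖) fun σ => by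
    rw [mul_comm]; exact Fock.abs_seq_le σ n x).continuous

instance truncation.instCompleteSpace (α : FinKrein V) : CompleteSpace (truncation α) := by
  suffices h : IsClosed (truncation α : Set (Fock V)) from h.completeSpace_coe
  have : (truncation α : Set (Fock V)) =
      ⋂ n, ⋂ x : Fin n → V, {σ | σ.seq n (fun k => α.proj (x k)) = σ.seq n x} := by
    ext σ
    simp only [Set.mem_iInter]
    refine ⟨fun h n x => ?_, fun h => ?_⟩
    · exact congrArg (fun g : FockSeq V => g n x) h
    · exact funext fun n => ContinuousAlternatingMap.ext fun x => h n x
  rw [this]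
  exact isClosed_iInter fun n => isClosed_iInter fun x =>
    isClosed_eq (Fock.continuous_apply _ _) (Fock.continuous_apply _ _)

/-- The orthogonal projector `P_α` of the Fock space onto `𝓕(V)_α`. -/
noncomputable def truncProj (α : FinKrein V) : Fock V →L[ℝ] Fock V :=
  (truncation α).starProjection

theorem truncation_mono {α β : FinKrein V} (h : α ≤ β) : truncation α ≤ truncation β := by
  intro σ hσ
  have := α.2.1
  have := β.2.1
  have hpp : ∀ x, α.proj (β.proj x) = α.proj x := by
    intro x
    have h1 : x - β.proj x ∈ β.1ᗮ := β.1.sub_starProjection_mem_orthogonal x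
    have h2 : α.proj (x - β.proj x) = 0 :=
      (Submodule.starProjection_apply_eq_zero_iff α.1).2 (Submodule.orthogonal_le h h1)
    rw [map_sub, sub_eq_zero] at h2
    exact h2.symm
  have hs : ∀ n (x : Fin n → V), σ.seq n (fun k => α.proj (x k)) = σ.seq n x := fun n x =>
    congrArg (fun g : FockSeq V => g n x) hσ
  refine funext fun n => ContinuousAlternatingMap.ext fun x => ?_
  change σ.seq n (fun k => β.proj (x k)) = σ.seq n x
  rw [← hs n x, ← hs n (fun k => β.proj (x k))]
  simp only [hpp]

variable (V) in
/-- The subspace of the Fock space of all elements that lie in some truncation `𝓕(V)_α`. -/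
noncomputable def truncated : Submodule ℝ (Fock V) where
  carrier := {σ | ∃ α : FinKrein V, σ ∈ truncation α}
  add_mem' := by
    rintro a b ⟨α, ha⟩ ⟨β, hb⟩
    have := α.2.1
    have := β.2.1
    have hs : ∀ x ∈ α.1 ⊔ β.1, KreinSpace.sym x ∈ α.1 ⊔ β.1 := by
      intro x hx
      obtain ⟨y, hy, z, hz, rfl⟩ := Submodule.mem_sup.1 hx
      rw [map_add]
      exact Submodule.add_mem_sup (α.2.2 y hy) (β.2.2 z hz)
    let γ : FinKrein V := ⟨α.1 ⊔ β.1, inferInstance, hs⟩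
    exact ⟨γ, (truncation γ).add_mem (truncation_mono (β := γ) (le_sup_left (a := α.1)) ha)
      (truncation_mono (β := γ) (le_sup_right (a := α.1) (b := β.1)) hb)⟩
  zero_mem' := ⟨⟨⊥, inferInstance, fun x hx => by
    rw [Submodule.mem_bot] at hx ⊢; rw [hx, map_zero]⟩, Submodule.zero_mem _⟩
  smul_mem' := by
    rintro c a ⟨α, ha⟩
    exact ⟨α, (truncation α).smul_mem c ha⟩

/-- The limit `k = lim_α k_α` of real numbers indexed by the finite dimensional Krein subspaces. -/
def IsDirectLimit (k : FinKrein V → ℝ) (l : ℝ) : Prop :=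
  ∀ ε > 0, ∃ β, ∀ γ ≥ β, |l - k γ| < ε

end Truncation

section Probability

variable {V : Type*} [NormedAddCommGroup V] [InnerProductSpace ℝ V] [KreinSpace V]

/-- The arguments `(z₁, …, zₙ, u zₙ, …, u z₁)`. -/
def probArgs (u : V →ₗ[ℝ] V) {n : ℕ} (z : Fin n → V) : Fin (2 * n) → V := fun j =>
  if h : (j : ℕ) < n then z ⟨j, h⟩ else u (z ⟨2 * n - 1 - j, by omega⟩)

/-- The summands, for an ON-basis `ζ`, of the probability map in degree `2n`. -/
noncomputable def probTerm {ι : Type*} (u : V →ₗ[ℝ] V) (σ : FockSeq V) (n : ℕ) (ζ : ι → V)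
    (i : Fin n → ι) : ℝ :=
  ((2 * n).factorial : ℝ) / (2 ^ n * n.factorial) * (-1) ^ n *
    ((-1) ^ (∑ k, sig (ζ (i k))) * σ (2 * n) (probArgs u fun k => ζ (i k)))

/-- The sums that define the probability map on `σ` converge, do not depend on the ON-basis, and
add up to `a`.  Components of odd degree do not contribute. -/
def HasProb (u : V →ₗ[ℝ] V) (σ : FockSeq V) (a : ℝ) : Prop :=
  ∃ s : ℕ → ℝ, (∀ n, ∀ B : Set V, IsONBasis ((↑) : B → V) →
    HasSum (probTerm u σ n ((↑) : B → V)) (s n)) ∧ HasSum s a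

/-- The domain of the probability map: the elements of the Fock space on which its defining sums
converge independently of the ON-basis. -/
def probDomain (u : V →ₗ[ℝ] V) : Set (FockSeq V) :=
  {σ | σ ∈ fockSubmodule V ∧ ∃ a, HasProb u σ a}

open Classical in
/-- The probability map on its domain (and `0` outside). -/
noncomputable def probMap (u : V →ₗ[ℝ] V) (σ : FockSeq V) : ℝ :=
  if h : ∃ a, HasProb u σ a then h.choose else 0

end Probability

/-- The combinatorial structure of a spacetime system: hypersurfaces and regions, with the ways of
decomposing, copying, uniting and gluing them.  Any collection of (sub)manifolds with these
operations gives one; slice regions are among the regions. -/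
structure SpacetimeSystem where
  /-- oriented hypersurfaces -/
  Hyp : Type*
  /-- regions -/
  Reg : Type*
  /-- orientation reversal of hypersurfaces -/
  rev : Hyp → Hyp
  rev_rev : ∀ S, rev (rev S) = S
  /-- the boundary of a region -/
  bdry : Reg → Hyp
  /-- the decompositions of `S` as a union of hypersurfaces `P 0, …, P (n-1)` -/
  Decomp : (S : Hyp) → {n : ℕ} → (P : Fin n → Hyp) → Type*
  /-- the identifications of `S'` as a copy of `S` -/
  Copy : (S S' : Hyp) → Type*
  /-- the presentations of `M` as a disjoint union of `M₁` and `M₂`, together with the induced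
  decompositions of the boundary -/
  DisjUnion : {M M₁ M₂ : Reg} → Decomp (bdry M) ![bdry M₁, bdry M₂] → Prop
  /-- `M₁` is obtained by gluing `M` to itself along `S` and `rev S'` -/
  Glue : {M M₁ : Reg} → {S S' : Hyp} → Decomp (bdry M) ![bdry M₁, S, rev S'] → Copy S S' → Prop

open KreinSpace in
/-- A classical free fermionic field theory on a spacetime system. -/
structure FermionicTheory (𝒮 : SpacetimeSystem) where
  /-- the separable real Krein space of germs of solutions on a hypersurface -/
  L : 𝒮.Hyp → Type*
  [instNACG : ∀ S, NormedAddCommGroup (L S)]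
  [instIPS : ∀ S, InnerProductSpace ℝ (L S)]
  [instKrein : ∀ S, KreinSpace (L S)]
  [instSep : ∀ S, TopologicalSpace.SeparableSpace (L S)]
  /-- orientation reversal, changing the sign of the indefinite inner product -/
  revL : ∀ S, L S ≃ₗᵢ[ℝ] L (𝒮.rev S)
  revL_revL : ∀ S (x : L S), revL (𝒮.rev S) (revL S x) ≍ x
  revL_sym : ∀ S (x : L S), sym (revL S x) = -revL S (sym x)
  /-- the isomorphism of Krein spaces from a decomposition to the direct sum -/
  decL : ∀ {S : 𝒮.Hyp} {n : ℕ} {P : Fin n → 𝒮.Hyp}, 𝒮.Decomp S P →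
    L S ≃ₗᵢ[ℝ] PiLp 2 fun i => L (P i)
  decL_sym : ∀ {S : 𝒮.Hyp} {n : ℕ} {P : Fin n → 𝒮.Hyp} (d : 𝒮.Decomp S P) (x : L S) (i : Fin n),
    decL d (sym x) i = sym (decL d x i)
  /-- copies of a hypersurface carry the same Krein space -/
  copyL : ∀ {S S' : 𝒮.Hyp}, 𝒮.Copy S S' → L S ≃ₗᵢ[ℝ] L S'
  copyL_sym : ∀ {S S' : 𝒮.Hyp} (c : 𝒮.Copy S S') (x : L S), copyL c (sym x) = sym (copyL c x)
  /-- the space of solutions in a region -/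
  Sol : 𝒮.Reg → Type*
  [instSolGroup : ∀ M, AddCommGroup (Sol M)]
  [instSolModule : ∀ M, Module ℝ (Sol M)]
  /-- the restriction of solutions to the boundary, with hypermaximal neutral image -/
  r : ∀ M, Sol M →ₗ[ℝ] L (𝒮.bdry M)
  range_r : ∀ M, IsHypermaximalNeutral (LinearMap.range (r M))
  /-- disjoint unions of regions -/
  union : ∀ {M M₁ M₂ : 𝒮.Reg} (d : 𝒮.Decomp (𝒮.bdry M) ![𝒮.bdry M₁, 𝒮.bdry M₂]),
    𝒮.DisjUnion d → ∃ e : Sol M ≃ₗ[ℝ] Sol M₁ × Sol M₂, ∀ x,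
      (decL d (r M x) 0 : L (𝒮.bdry M₁)) = r M₁ (e x).1 ∧
      (decL d (r M x) 1 : L (𝒮.bdry M₂)) = r M₂ (e x).2
  /-- gluing: solutions on the glued region are the solutions on the original region that agree
  on the two copies of the gluing hypersurface -/
  glue : ∀ {M M₁ : 𝒮.Reg} {S S' : 𝒮.Hyp}
    (d : 𝒮.Decomp (𝒮.bdry M) ![𝒮.bdry M₁, S, 𝒮.rev S']) (c : 𝒮.Copy S S'), 𝒮.Glue d c →
    ∃ j : Sol M₁ →ₗ[ℝ] Sol M, Function.Injective j ∧
      (∀ y, y ∈ LinearMap.range j ↔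
        (decL d (r M y) 2 : L (𝒮.rev S')) = revL S' (copyL c (decL d (r M y) 1 : L S))) ∧
      ∀ x, (decL d (r M (j x)) 0 : L (𝒮.bdry M₁)) = r M₁ x

namespace FermionicTheory

attribute [instance] instNACG instIPS instKrein instSep instSolGroup instSolModule

/-- The component `L_{∂M} → L_{P i}` of the isomorphism given by a decomposition. -/
noncomputable def pr {𝒮 : SpacetimeSystem} (T : FermionicTheory 𝒮) {S : 𝒮.Hyp} {n : ℕ}
    {P : Fin n → 𝒮.Hyp} (d : 𝒮.Decomp S P) (i : Fin n) : T.L S →L[ℝ] T.L (P i) :=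
  (PiLp.proj 2 (fun i => T.L (P i)) i).comp (T.decL d).toContinuousLinearEquiv.toContinuousLinearMap

/-- The real Krein space `𝓓_S` of a hypersurface: the real Fock space over `L_S`. -/
abbrev D {𝒮 : SpacetimeSystem} (T : FermionicTheory 𝒮) (S : 𝒮.Hyp) : Type _ := Fock (T.L S)

/-- The involution `u_M` determined by the image of the solutions in `M`. -/
noncomputable def u {𝒮 : SpacetimeSystem} (T : FermionicTheory 𝒮) (M : 𝒮.Reg) :
    T.L (𝒮.bdry M) →ₗ[ℝ] T.L (𝒮.bdry M) :=
  reversal (LinearMap.range (T.r M)) (T.range_r M)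

/-- The domain of the probability map `A_M`. -/
def domA {𝒮 : SpacetimeSystem} (T : FermionicTheory 𝒮) (M : 𝒮.Reg) :
    Set (FockSeq (T.L (𝒮.bdry M))) := probDomain (T.u M)

/-- The probability map `A_M`. -/
noncomputable def A {𝒮 : SpacetimeSystem} (T : FermionicTheory 𝒮) (M : 𝒮.Reg)
    (σ : FockSeq (T.L (𝒮.bdry M))) : ℝ := probMap (T.u M) σ

/-- The identification of elements of the Fock space of `S` with forms on the Krein space of
`rev S'`, where `S'` is a copy of `S`; the order of the arguments is reversed. -/
noncomputable def flip {𝒮 : SpacetimeSystem} (T : FermionicTheory 𝒮) {S S' : 𝒮.Hyp}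
    (c : 𝒮.Copy S S') (ξ : FockSeq (T.L S)) : FockSeq (T.L (𝒮.rev S')) :=
  FockSeq.pullback ((T.copyL c).trans (T.revL S')).symm.toContinuousLinearEquiv.toContinuousLinearMap
    ξ.reverse

/-- `τ*(σ ⊗ ξ ⊗ ξ')` for the decomposition `∂M = ∂M₁ ∪ S ∪ rev S'`, where the element `ξ'` of `𝓓_S`
is identified with an element of `𝓓_{rev S'}`. -/
noncomputable def tau {𝒮 : SpacetimeSystem} (T : FermionicTheory 𝒮) {M M₁ : 𝒮.Reg} {S S' : 𝒮.Hyp}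
    (d : 𝒮.Decomp (𝒮.bdry M) ![𝒮.bdry M₁, S, 𝒮.rev S']) (c : 𝒮.Copy S S')
    (σ : T.D (𝒮.bdry M₁)) (ξ ξ' : T.D S) : FockSeq (T.L (𝒮.bdry M)) :=
  ((FockSeq.pullback (W := T.L (𝒮.bdry M₁)) (T.pr d 0) σ.seq).wedge
    (FockSeq.pullback (W := T.L S) (T.pr d 1) ξ.seq)).wedge
      (FockSeq.pullback (W := T.L (𝒮.rev S')) (T.pr d 2) (T.flip c ξ'.seq))

/-- The summand `(-1)^[ξ] A_M(τ*(σ ⊗ P_γ ξ ⊗ P_γ ξ))`. -/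
noncomputable def glueTerm {𝒮 : SpacetimeSystem} (T : FermionicTheory 𝒮) {M M₁ : 𝒮.Reg}
    {S S' : 𝒮.Hyp} (d : 𝒮.Decomp (𝒮.bdry M) ![𝒮.bdry M₁, S, 𝒮.rev S']) (c : 𝒮.Copy S S')
    (σ : T.D (𝒮.bdry M₁)) (γ : FinKrein (T.L S)) (ξ : T.D S) : ℝ :=
  (-1) ^ sig ξ * T.A M (T.tau d c σ (truncProj γ ξ) (truncProj γ ξ))

/-- The gluing anomaly factor `ĉ_γ`, computed in one chosen ON-basis of `𝓓_S`. -/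
noncomputable def cHat {𝒮 : SpacetimeSystem} (T : FermionicTheory 𝒮) {M M₁ : 𝒮.Reg}
    {S S' : 𝒮.Hyp} (d : 𝒮.Decomp (𝒮.bdry M) ![𝒮.bdry M₁, S, 𝒮.rev S']) (c : 𝒮.Copy S S')
    (γ : FinKrein (T.L S)) : ℝ :=
  ∑' ξ : onBasis (T.D S), T.glueTerm d c Fock.one γ ξ

end FermionicTheory

/-!
All forms that occur in truncations are finite sums of wedge products of continuous linear forms.
Representing linear forms by vectors, such sequences of forms are the image of the exterior algebra
of the one-particle space under `FermiAlgebra.toForms`, which sends the product of the algebra to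
the antisymmetrized product of forms (`toForms_mul`) and hits every element of a truncation
(`exists_toFock_eq`).

On the exterior algebra the probability map of a hypermaximal neutral subspace `N` with reversal `u`
is a Gaussian (Berezin) functional `gauss`: with the antisymmetric operator `h = u ∘ sym` it is
`vac ∘ exp (-½ C)`, where `C` is the sum of the double interior products with `ζᵢ` and `h ζᵢ` over
any ON-basis. The sums converge and do not depend on the basis because they are Hilbert space inner
products (`hasProb_toForms`, `probMap_toForms`). The Gaussian functional is characterized by the
value `1` at `1` and the integration by parts `gauss (x ∧ s) = -gauss (h x ⌟ s)` (`gauss_ι_mul`).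

Summing over an ON-basis of the Fock space, with projectors onto the truncation by `γ`, is a trace
over a finite dimensional space (`hasSum_trace`), which may be evaluated in the monomials of an
ON-basis `x₁, …, xₘ` of `γ`. The resulting factor is the copairing element
`∏ᵢ (1 + (j₁ (sym xᵢ)) ∧ (j₂ xᵢ))`, where `j₁`, `j₂` are the inclusions of the two copies of the
gluing hypersurface (`hasSum_glue`). Hence the factor `ĉ_γ` is the Gaussian functional of the
copairing element, and the claim is the factorization
`gauss (j₀ s ∧ copairing) = gauss₁ s * gauss copairing`.

For this, the left side satisfies the integration by parts of `gauss₁`: every `y` has an extension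
`X = j₀ y + …` to the boundary of the original region such that the interior product with `-h X`
acts on the factor `j₀ s` as that with `-h₁ y`, and on the copairing element as multiplication by
`X - j₀ y`. It arises by writing `sym y = a + b` with `a` and `sym b` in the space of solutions of
the glued region, and extending these two to solutions of the original region whose components
`l`, `m` on the two copies of the gluing hypersurface agree; the requirement on `γ` is to contain
`l` and `m` (`exists_extension`, `gauss_ι_mul_copairing`). It suffices to treat the finitely many `y` in
an ON-basis of the truncation of `∂M₁`, so a single `γ` serves all of them
(`exists_gauss_copairing_eq`).
-/

/-! ### Interior products on the exterior algebra of an inner product space -/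

namespace FermiAlgebra

open ExteriorAlgebra MulOpposite

variable {V W : Type*} [NormedAddCommGroup V] [InnerProductSpace ℝ V]
  [NormedAddCommGroup W] [InnerProductSpace ℝ W]

/-- The interior product `v ⌟ w` of an element `w` of the exterior algebra with (the linear form
dual to) the vector `v`. -/
noncomputable def interior :
    V →ₗ[ℝ] ExteriorAlgebra ℝ V →ₗ[ℝ] ExteriorAlgebra ℝ V :=
  (CliffordAlgebra.contractLeft (Q := (0 : QuadraticForm ℝ V))).comp (innerₗ V)

/-- The degree zero component of an element of the exterior algebra. -/
noncomputable def vac : ExteriorAlgebra ℝ V →ₗ[ℝ] ℝ :=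
  (algebraMapInv (R := ℝ) (M := V)).toLinearMap

theorem vac_one : vac (1 : ExteriorAlgebra ℝ V) = 1 := map_one (algebraMapInv (R := ℝ) (M := V))

theorem vac_ι_mul (x : V) (w : ExteriorAlgebra ℝ V) : vac (ι ℝ x * w) = 0 := by
  change algebraMapInv (R := ℝ) (ι ℝ x * w) = 0
  rw [map_mul]
  simp [algebraMapInv]

theorem interior_ι_mul (v x : V) (w : ExteriorAlgebra ℝ V) :
    interior v (ι ℝ x * w) = inner ℝ v x • w - ι ℝ x * interior v w :=
  CliffordAlgebra.contractLeft_ι_mul _ _ _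

theorem interior_one (v : V) : interior v (1 : ExteriorAlgebra ℝ V) = 0 :=
  CliffordAlgebra.contractLeft_one _ _

theorem interior_interior (v : V) (w : ExteriorAlgebra ℝ V) : interior v (interior v w) = 0 :=
  CliffordAlgebra.contractLeft_contractLeft _ _

theorem interior_comm (v v' : V) (w : ExteriorAlgebra ℝ V) :
    interior v (interior v' w) = -interior v' (interior v w) :=
  CliffordAlgebra.contractLeft_comm _ _ _

/-- Induction over products of vectors, peeling off one vector on the left. -/
@[elab_as_elim]
theorem left_induction {P : ExteriorAlgebra ℝ V → Prop} (one : P 1)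
    (smul : ∀ (c : ℝ) w, P w → P (c • w)) (add : ∀ w w', P w → P w' → P (w + w'))
    (ι_mul : ∀ (x : V) w, P w → P (ι ℝ x * w)) (w : ExteriorAlgebra ℝ V) : P w := by
  refine CliffordAlgebra.left_induction (P := P) _ ?_ add (fun w x h => ι_mul x w h) w
  intro r
  rw [Algebra.algebraMap_eq_smul_one]
  exact smul r _ one

theorem ι_mul_ι_comm (x y : V) : ι ℝ x * ι ℝ y = -(ι ℝ y * ι ℝ x) :=
  eq_neg_of_add_eq_zero_left (ι_add_mul_swap x y)

/-- The grade involution, `-1` on vectors. -/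
noncomputable def parity : ExteriorAlgebra ℝ V →ₐ[ℝ] ExteriorAlgebra ℝ V :=
  CliffordAlgebra.involute

theorem parity_ι (x : V) : parity (ι ℝ x) = -ι ℝ x := CliffordAlgebra.involute_ι x

/-- Moving a vector to the left past an element costs the grade involution. -/
theorem mul_ι (x : V) (w : ExteriorAlgebra ℝ V) : parity w * ι ℝ x = ι ℝ x * w := by
  induction w using left_induction with
  | one => simp
  | smul c w h => rw [map_smul, smul_mul_assoc, h, mul_smul_comm]
  | add w w' h h' => rw [map_add, add_mul, h, h', mul_add]
  | ι_mul y w h =>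
    rw [map_mul, parity_ι, mul_assoc, h, ← mul_assoc, ← mul_assoc, ι_mul_ι_comm x y, neg_mul]

/-- The interior product is a graded derivation. -/
theorem interior_mul (v : V) (w w' : ExteriorAlgebra ℝ V) :
    interior v (w * w') = interior v w * w' + parity w * interior v w' := by
  induction w using left_induction with
  | one => simp [interior_one]
  | smul c w h => simp only [smul_mul_assoc, map_smul, h, smul_add]
  | add w u h h' => simp only [add_mul, map_add, h, h']; abel
  | ι_mul y w h =>
    rw [mul_assoc, interior_ι_mul, h, interior_ι_mul, map_mul, parity_ι]
    simp only [sub_mul, mul_add, smul_mul_assoc, mul_assoc, neg_mul]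
    abel

/-- The interior product with `v` corresponds to that with the image of `v` under the adjoint `p` of
`f`. -/
theorem interior_map (f : W →ₗ[ℝ] V) (p : V → W) (hp : ∀ x v, inner ℝ v (f x) = inner ℝ (p v) x)
    (v : V) (w : ExteriorAlgebra ℝ W) :
    interior v (map f w) = map f (interior (p v) w) := by
  induction w using left_induction with
  | one => simp [interior_one]
  | smul c w h => simp only [map_smul, h]
  | add w u h h' => simp only [map_add, h, h']
  | ι_mul y w h =>
    rw [map_mul, map_apply_ι, interior_ι_mul, interior_ι_mul, h, hp, map_sub, map_smul, map_mul,
      map_apply_ι]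

theorem vac_map (f : W →ₗ[ℝ] V) (w : ExteriorAlgebra ℝ W) : vac (map f w) = vac w := by
  induction w using left_induction with
  | one => simp [vac_one]
  | smul c w h => simp only [map_smul, h]
  | add w u h h' => simp only [map_add, h, h']
  | ι_mul y w h => rw [map_mul, map_apply_ι, vac_ι_mul, vac_ι_mul]

/-- Expansion of the interior product with a product of vectors. -/
theorem interior_ιMulti (v : V) {n : ℕ} (x : Fin (n + 1) → V) :
    interior v (ιMulti ℝ (n + 1) x) =
      ∑ i : Fin (n + 1), ((-1 : ℝ) ^ (i : ℕ) * inner ℝ v (x i)) •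
        ιMulti ℝ n (fun j => x (i.succAbove j)) := by
  induction n with
  | zero =>
    rw [ιMulti_succ_apply, interior_ι_mul]
    simp [ιMulti_zero_apply, interior_one]
  | succ n ih =>
    rw [ιMulti_succ_apply, interior_ι_mul, Fin.sum_univ_succ, ih, Finset.mul_sum,
      sub_eq_add_neg, ← Finset.sum_neg_distrib]
    congr 1
    · simp only [Fin.val_zero, pow_zero, one_mul]
      rfl
    · refine Finset.sum_congr rfl fun i _ => ?_
      rw [ιMulti_succ_apply (fun j => x (i.succ.succAbove j)), mul_smul_comm, ← neg_smul]
      congr 1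
      · simp [Matrix.vecTail, pow_succ]
      · congr 2
        ext j
        simp [Matrix.vecTail]

/-- The iterated interior product `v_{k-1} ⌟ (⋯ ⌟ (v₀ ⌟ w))`. -/
noncomputable def interiors :
    {k : ℕ} → (Fin k → V) → ExteriorAlgebra ℝ V →ₗ[ℝ] ExteriorAlgebra ℝ V
  | 0, _ => LinearMap.id
  | _ + 1, v => (interiors (Fin.tail v)).comp (interior (v 0))

theorem interiors_zero (v : Fin 0 → V) (w : ExteriorAlgebra ℝ V) : interiors v w = w := rfl

theorem interiors_succ {k : ℕ} (v : Fin (k + 1) → V) (w : ExteriorAlgebra ℝ V) :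
    interiors v w = interiors (Fin.tail v) (interior (v 0) w) := rfl

/-- Interior products define an action of the opposite of the exterior algebra on itself. -/
noncomputable def interiorHom :
    ExteriorAlgebra ℝ V →ₐ[ℝ] (Module.End ℝ (ExteriorAlgebra ℝ V))ᵐᵒᵖ :=
  ExteriorAlgebra.lift ℝ ⟨(opLinearEquiv ℝ).toLinearMap.comp interior, fun v => by
    change op (interior v) * op (interior v) = 0
    rw [← op_mul]
    refine (congrArg op (LinearMap.ext fun w => ?_)).trans op_zero
    exact interior_interior v w⟩

theorem unop_interiorHom_ιMulti {k : ℕ} (v : Fin k → V) :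
    unop (interiorHom (ιMulti ℝ k v)) = interiors v := by
  induction k with
  | zero => rw [ιMulti_zero_apply, map_one]; rfl
  | succ k ih =>
    rw [ιMulti_succ_apply, map_mul, unop_mul]
    have h : unop (interiorHom (ι ℝ (v 0))) = interior (v 0) := by
      rw [interiorHom, lift_ι_apply]; rfl
    rw [h]
    exact congrArg (· * interior (v 0)) (ih _)

/-- The alternating form `v ↦ ⟨v_{k-1} ⌟ ⋯ v₀ ⌟ w⟩₀`. -/
noncomputable def interiorForm (k : ℕ) (w : ExteriorAlgebra ℝ V) : V [⋀^Fin k]→ₗ[ℝ] ℝ :=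
  ((vac.comp (LinearMap.applyₗ w)).comp
    ((opLinearEquiv ℝ).symm.toLinearMap.comp interiorHom.toLinearMap)).compAlternatingMap
      (ιMulti ℝ k)

theorem interiorForm_apply (k : ℕ) (w : ExteriorAlgebra ℝ V) (v : Fin k → V) :
    interiorForm k w v = vac (interiors v w) := by
  rw [← unop_interiorHom_ιMulti]; rfl

/-- The map `v ↦ v ⌟ w` has finite rank. -/
theorem exists_interior_eq (w : ExteriorAlgebra ℝ V) : ∃ (m : ℕ) (f : Fin m → V)
    (g : Fin m → ExteriorAlgebra ℝ V), ∀ v, interior v w = ∑ j, inner ℝ v (f j) • g j := by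
  induction w using left_induction with
  | one => exact ⟨0, Fin.elim0, Fin.elim0, fun v => by simp [interior_one]⟩
  | smul c w h =>
    obtain ⟨m, f, g, h⟩ := h
    exact ⟨m, f, fun j => c • g j, fun v => by
      simp only [map_smul, h, Finset.smul_sum, smul_comm c]⟩
  | add w u h h' =>
    obtain ⟨m, f, g, h⟩ := h
    obtain ⟨m', f', g', h'⟩ := h'
    exact ⟨m + m', Fin.append f f', Fin.append g g', fun v => by
      simp [Fin.sum_univ_add, h, h']⟩
  | ι_mul y w h =>
    obtain ⟨m, f, g, h⟩ := h
    refine ⟨m + 1, Fin.cons y f, Fin.cons w fun j => -(ι ℝ y * g j), fun v => ?_⟩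
    simp [Fin.sum_univ_succ, interior_ι_mul, h, Finset.mul_sum, sub_eq_add_neg]

/-- Continuity in infinite dimensions comes from the finite rank of interior products. -/
theorem continuous_interiorForm (k : ℕ) (w : ExteriorAlgebra ℝ V) :
    Continuous fun v : Fin k → V => interiorForm k w v := by
  simp only [interiorForm_apply]
  induction k generalizing w with
  | zero => exact (continuous_const : Continuous fun _ : Fin 0 → V => vac w)
  | succ k ih =>
    obtain ⟨m, f, g, h⟩ := exists_interior_eq w
    simp only [interiors_succ, h, map_sum, map_smul, smul_eq_mul]
    refine continuous_finsetSum _ fun j _ => ?_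
    have h1 : Continuous fun v : Fin (k + 1) → V => Fin.tail v := by
      unfold Fin.tail
      fun_prop
    have h2 : Continuous fun v : Fin (k + 1) → V => (inner ℝ (v 0) (f j) : ℝ) := by fun_prop
    exact h2.mul ((ih (g j)).comp h1)

/-- The sequence of antisymmetric forms represented by an element of the exterior algebra: a
product `x₁ ⋯ xₙ` of vectors represents the normalized form
`(v₁, …, vₙ) ↦ (1 / n!) det ⟪vⱼ, xᵢ⟫`. -/
noncomputable def toForms : ExteriorAlgebra ℝ V →ₗ[ℝ] FockSeq V where
  toFun w k := (k.factorial : ℝ)⁻¹ •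
    (⟨⟨(interiorForm k w).toMultilinearMap, continuous_interiorForm k w⟩,
      (interiorForm k w).map_eq_zero_of_eq'⟩ : V [⋀^Fin k]→L[ℝ] ℝ)
  map_add' w w' := by
    funext k
    ext v
    change (k.factorial : ℝ)⁻¹ * interiorForm k (w + w') v =
      (k.factorial : ℝ)⁻¹ * interiorForm k w v + (k.factorial : ℝ)⁻¹ * interiorForm k w' v
    simp only [interiorForm_apply, map_add, mul_add]
  map_smul' c w := by
    funext k
    ext v
    change (k.factorial : ℝ)⁻¹ * interiorForm k (c • w) v =
      c * ((k.factorial : ℝ)⁻¹ * interiorForm k w v)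
    simp only [interiorForm_apply, map_smul, smul_eq_mul]
    ring

theorem toForms_apply (w : ExteriorAlgebra ℝ V) (k : ℕ) (v : Fin k → V) :
    toForms w k v = (k.factorial : ℝ)⁻¹ * vac (interiors v w) := by
  rw [← interiorForm_apply]; rfl

/-! ### Products of vectors as determinants -/

theorem vac_interiors_ιMulti_of_ne (k m : ℕ) (v : Fin k → V) (x : Fin m → V) (h : k ≠ m) :
    vac (interiors v (ιMulti ℝ m x)) = 0 := by
  induction k generalizing m with
  | zero =>
    obtain ⟨m, rfl⟩ := Nat.exists_eq_succ_of_ne_zero h.symm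
    rw [ιMulti_succ_apply, interiors_zero, vac_ι_mul]
  | succ k ih =>
    rcases m with _ | m
    · rw [ιMulti_zero_apply, interiors_succ, interior_one, map_zero, map_zero]
    · rw [interiors_succ, interior_ιMulti, map_sum, map_sum]
      refine Finset.sum_eq_zero fun i _ => ?_
      rw [map_smul, map_smul, ih _ _ _ (by omega), smul_zero]

theorem vac_interiors_ιMulti (k : ℕ) (v x : Fin k → V) :
    vac (interiors v (ιMulti ℝ k x)) = (Matrix.of fun i j => inner ℝ (v j) (x i)).det := by
  induction k with
  | zero => rw [ιMulti_zero_apply, interiors_zero, vac_one, Matrix.det_fin_zero]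
  | succ k ih =>
    rw [interiors_succ, interior_ιMulti, map_sum, map_sum, Matrix.det_succ_column_zero]
    refine Finset.sum_congr rfl fun i _ => ?_
    rw [map_smul, map_smul, ih]
    rfl

end FermiAlgebra

/-! ### Forms represented by the exterior algebra -/

namespace FermiAlgebra

open ExteriorAlgebra

variable {V W : Type*} [NormedAddCommGroup V] [InnerProductSpace ℝ V]
  [NormedAddCommGroup W] [InnerProductSpace ℝ W]

theorem ιMulti_induction {P : ExteriorAlgebra ℝ V → Prop}
    (ιMulti : ∀ (n : ℕ) (x : Fin n → V), P (ιMulti ℝ n x))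
    (smul : ∀ (c : ℝ) w, P w → P (c • w)) (add : ∀ w w', P w → P w' → P (w + w'))
    (w : ExteriorAlgebra ℝ V) : P w := by
  have hw : w ∈ Submodule.span ℝ
      (Set.range fun x : Σ n, (Fin n → V) => ExteriorAlgebra.ιMulti ℝ x.1 x.2) := by
    rw [ExteriorAlgebra.ιMulti_span]; trivial
  induction hw using Submodule.span_induction with
  | mem x h => obtain ⟨y, rfl⟩ := h; exact ιMulti _ _
  | zero => simpa using smul 0 _ (ιMulti 0 Fin.elim0)
  | add x y _ _ hx hy => exact add x y hx hy
  | smul c x _ hx => exact smul c x hx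

theorem toForms_ιMulti {k n : ℕ} (h : k = n) (x : Fin n → V) (v : Fin k → V) :
    toForms (ιMulti ℝ n x) k v =
      (n.factorial : ℝ)⁻¹ * (Matrix.of fun i j => inner ℝ (v (Fin.cast h.symm j)) (x i)).det := by
  subst h
  rw [toForms_apply, vac_interiors_ιMulti]
  rfl

theorem toForms_ιMulti_of_ne {k n : ℕ} (h : k ≠ n) (x : Fin n → V) (v : Fin k → V) :
    toForms (ιMulti ℝ n x) k v = 0 := by
  rw [toForms_apply, vac_interiors_ιMulti_of_ne _ _ _ _ h, mul_zero]

/-- Laplace expansion along the first `m` rows, as a sum over all permutations of the columns. -/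
theorem sum_perm_det_mul_det {m n : ℕ} (A : Matrix (Fin (m + n)) (Fin (m + n)) ℝ) :
    ∑ τ : Equiv.Perm (Fin (m + n)), ((Equiv.Perm.sign τ : ℤ) : ℝ) *
      ((Matrix.of fun i j => A (Fin.castAdd n i) (τ (Fin.castAdd n j))).det *
        (Matrix.of fun i j => A (Fin.natAdd m i) (τ (Fin.natAdd m j))).det) =
      m.factorial * n.factorial * A.det := by
  -- Expand both minors; for fixed `ρ`, `κ` the substitution `τ ↦ τ ∘ (ρ ⊕ κ)` leaves the full
  -- determinant.
  have key : ∀ (ρ : Equiv.Perm (Fin m)) (κ : Equiv.Perm (Fin n)),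
      ∑ τ : Equiv.Perm (Fin (m + n)), ((Equiv.Perm.sign τ : ℤ) : ℝ) *
        ((((Equiv.Perm.sign ρ : ℤ) : ℝ) * ∏ i, A (Fin.castAdd n i) (τ (Fin.castAdd n (ρ i)))) *
          (((Equiv.Perm.sign κ : ℤ) : ℝ) * ∏ i, A (Fin.natAdd m i) (τ (Fin.natAdd m (κ i))))) =
        A.det := by
    intro ρ κ
    rw [← Matrix.det_transpose, Matrix.det_apply']
    refine Fintype.sum_equiv
      (Equiv.mulRight (finSumFinEquiv.permCongr (Equiv.Perm.sumCongr ρ κ))) _ _ fun τ => ?_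
    rw [Fin.prod_univ_add, Equiv.coe_mulRight, Equiv.Perm.sign_mul, Equiv.Perm.sign_permCongr,
      Equiv.Perm.sign_sumCongr]
    simp only [Units.val_mul, Int.cast_mul, Matrix.transpose_apply, Equiv.Perm.coe_mul,
      Function.comp_apply, Equiv.permCongr_apply, finSumFinEquiv_symm_apply_castAdd,
      finSumFinEquiv_symm_apply_natAdd, Equiv.Perm.sumCongr_apply, Sum.map_inl, Sum.map_inr,
      finSumFinEquiv_apply_left, finSumFinEquiv_apply_right]
    ring
  have h1 : ∀ τ : Equiv.Perm (Fin (m + n)),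
      (Matrix.of fun i j => A (Fin.castAdd n i) (τ (Fin.castAdd n j))).det =
        ∑ ρ : Equiv.Perm (Fin m), ((Equiv.Perm.sign ρ : ℤ) : ℝ) *
          ∏ i, A (Fin.castAdd n i) (τ (Fin.castAdd n (ρ i))) := fun τ => by
    rw [← Matrix.det_transpose, Matrix.det_apply']; rfl
  have h2 : ∀ τ : Equiv.Perm (Fin (m + n)),
      (Matrix.of fun i j => A (Fin.natAdd m i) (τ (Fin.natAdd m j))).det =
        ∑ κ : Equiv.Perm (Fin n), ((Equiv.Perm.sign κ : ℤ) : ℝ) *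
          ∏ i, A (Fin.natAdd m i) (τ (Fin.natAdd m (κ i))) := fun τ => by
    rw [← Matrix.det_transpose, Matrix.det_apply']; rfl
  have h3 : ∀ τ : Equiv.Perm (Fin (m + n)), ((Equiv.Perm.sign τ : ℤ) : ℝ) *
      ((Matrix.of fun i j => A (Fin.castAdd n i) (τ (Fin.castAdd n j))).det *
        (Matrix.of fun i j => A (Fin.natAdd m i) (τ (Fin.natAdd m j))).det) =
      ∑ ρ : Equiv.Perm (Fin m), ∑ κ : Equiv.Perm (Fin n), ((Equiv.Perm.sign τ : ℤ) : ℝ) *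
        ((((Equiv.Perm.sign ρ : ℤ) : ℝ) * ∏ i, A (Fin.castAdd n i) (τ (Fin.castAdd n (ρ i)))) *
          (((Equiv.Perm.sign κ : ℤ) : ℝ) * ∏ i, A (Fin.natAdd m i) (τ (Fin.natAdd m (κ i))))) := by
    intro τ
    rw [h1, h2, Finset.sum_mul_sum, Finset.mul_sum]
    exact Finset.sum_congr rfl fun ρ _ => Finset.mul_sum _ _ _
  rw [Finset.sum_congr rfl fun τ _ => h3 τ, Finset.sum_comm]
  refine (Finset.sum_congr rfl fun ρ _ => Finset.sum_comm.trans
    (Finset.sum_congr rfl fun κ _ => key ρ κ)).trans ?_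
  simp [Fintype.card_perm]
  ring

theorem wedge_add_left (a a' b : FockSeq V) :
    FockSeq.wedge (a + a') b = FockSeq.wedge a b + FockSeq.wedge a' b := by
  funext k
  ext v
  change _ = FockSeq.wedge a b k v + FockSeq.wedge a' b k v
  simp only [FockSeq.wedge_apply, Pi.add_apply, ContinuousAlternatingMap.add_apply, add_mul,
    mul_add, Finset.sum_add_distrib]

theorem wedge_add_right (a b b' : FockSeq V) :
    FockSeq.wedge a (b + b') = FockSeq.wedge a b + FockSeq.wedge a b' := by
  funext k
  ext v
  change _ = FockSeq.wedge a b k v + FockSeq.wedge a b' k v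
  simp only [FockSeq.wedge_apply, Pi.add_apply, ContinuousAlternatingMap.add_apply,
    mul_add, Finset.sum_add_distrib]

theorem wedge_smul_left (c : ℝ) (a b : FockSeq V) :
    FockSeq.wedge (c • a) b = c • FockSeq.wedge a b := by
  funext k
  ext v
  change _ = c * FockSeq.wedge a b k v
  simp only [FockSeq.wedge_apply, Pi.smul_apply, ContinuousAlternatingMap.smul_apply, smul_eq_mul,
    Finset.mul_sum]
  exact Finset.sum_congr rfl fun _ _ => Finset.sum_congr rfl fun _ _ => by ring

theorem wedge_smul_right (c : ℝ) (a b : FockSeq V) :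
    FockSeq.wedge a (c • b) = c • FockSeq.wedge a b := by
  funext k
  ext v
  change _ = c * FockSeq.wedge a b k v
  simp only [FockSeq.wedge_apply, Pi.smul_apply, ContinuousAlternatingMap.smul_apply, smul_eq_mul,
    Finset.mul_sum]
  exact Finset.sum_congr rfl fun _ _ => Finset.sum_congr rfl fun _ _ => by ring

theorem wedge_toForms_ιMulti {m n : ℕ} (x : Fin m → V) (y : Fin n → V) :
    FockSeq.wedge (toForms (ιMulti ℝ m x)) (toForms (ιMulti ℝ n y)) =
      toForms (ιMulti ℝ (m + n) (Fin.append x y)) := by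
  funext k
  ext v
  rw [FockSeq.wedge_apply]
  by_cases hk : k = m + n
  · subst hk
    have hd : ∀ j : Fin n, (j : ℕ) < m + n - m := fun j => by have := j.2; omega
    rw [Finset.sum_eq_single ⟨m, by omega⟩, toForms_ιMulti rfl]
    · have h := sum_perm_det_mul_det
        (Matrix.of fun i j => inner ℝ (v j) (Fin.append x y i))
      simp only [Matrix.of_apply, Fin.append_left, Fin.append_right] at h
      have h1 : ∀ τ : Equiv.Perm (Fin (m + n)),
          toForms (ιMulti ℝ m x) m (fun i => v (τ ⟨i, by omega⟩)) *
            toForms (ιMulti ℝ n y) (m + n - m) (fun j => v (τ ⟨m + j, by omega⟩)) =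
          ((m.factorial : ℝ)⁻¹ * (n.factorial : ℝ)⁻¹) *
          ((Matrix.of fun i j => inner ℝ (v (τ (Fin.castAdd n j))) (x i)).det *
            (Matrix.of fun i j => inner ℝ (v (τ (Fin.natAdd m j))) (y i)).det) := by
        intro τ
        rw [toForms_ιMulti rfl, toForms_ιMulti (by omega : m + n - m = n), mul_mul_mul_comm]
        rfl
      simp only [h1, mul_left_comm _ ((m.factorial : ℝ)⁻¹ * (n.factorial : ℝ)⁻¹)]
      rw [← Finset.mul_sum, h]
      have hm : (m.factorial : ℝ) ≠ 0 := by exact_mod_cast m.factorial_ne_zero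
      have hn : (n.factorial : ℝ) ≠ 0 := by exact_mod_cast n.factorial_ne_zero
      field_simp
      rfl
    · intro j _ hj
      have : (j : ℕ) ≠ m := fun e => hj (Fin.ext e)
      simp only [toForms_ιMulti_of_ne this, zero_mul, mul_zero, Finset.sum_const_zero]
    · simp
  · rw [toForms_ιMulti_of_ne hk]
    refine Finset.sum_eq_zero fun j _ => ?_
    by_cases hj : (j : ℕ) = m
    · have : k - (j : ℕ) ≠ n := by have := j.2; omega
      simp only [toForms_ιMulti_of_ne this, mul_zero, Finset.sum_const_zero]
    · simp only [toForms_ιMulti_of_ne hj, zero_mul, mul_zero, Finset.sum_const_zero]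

/-- The antisymmetrized product of forms corresponds to the product of the exterior algebra. -/
theorem toForms_mul (w w' : ExteriorAlgebra ℝ V) :
    toForms (w * w') = FockSeq.wedge (toForms w) (toForms w') := by
  induction w using ιMulti_induction with
  | smul c w h => rw [smul_mul_assoc, map_smul, map_smul, h, wedge_smul_left]
  | add w u h h' => rw [add_mul, map_add, map_add, h, h', wedge_add_left]
  | ιMulti m x =>
    induction w' using ιMulti_induction with
    | smul c w h => rw [mul_smul_comm, map_smul, map_smul, h, wedge_smul_right]
    | add w u h h' => rw [mul_add, map_add, map_add, h, h', wedge_add_right]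
    | ιMulti n y => rw [wedge_toForms_ιMulti, ιMulti_mul_ιMulti]

/-- The pullback of forms along `p` corresponds to the functorial action of its adjoint. -/
theorem pullback_toForms (f : W →ₗ[ℝ] V) (p : V →L[ℝ] W)
    (hp : ∀ x v, inner ℝ v (f x) = inner ℝ (p v) x) (w : ExteriorAlgebra ℝ W) :
    FockSeq.pullback p (toForms w) = toForms (map f w) := by
  funext k
  ext v
  change toForms w k (fun i => p (v i)) = _
  rw [toForms_apply, toForms_apply]
  congr 1
  induction k generalizing w with
  | zero => rw [interiors_zero, interiors_zero, vac_map]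
  | succ k ih =>
    rw [interiors_succ, interiors_succ, interior_map f p hp]
    exact ih _ _

theorem reverse_ιMulti (n : ℕ) (x : Fin n → V) :
    CliffordAlgebra.reverse (ιMulti ℝ n x) = ιMulti ℝ n fun i => x i.rev := by
  have h := CliffordAlgebra.reverse_prod_map_ι (Q := (0 : QuadraticForm ℝ V)) (List.ofFn x)
  rw [List.map_ofFn] at h
  rw [ιMulti_apply, ιMulti_apply]
  refine h.trans (congrArg List.prod ?_)
  refine List.ext_getElem (by simp) fun i h1 h2 => ?_
  simp only [List.getElem_reverse, List.getElem_ofFn, Function.comp_apply, List.length_ofFn]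
  congr 2
  exact Fin.ext (by simp [Fin.rev]; omega)

/-- Reversal of the arguments of forms corresponds to reversal in the exterior algebra. -/
theorem reverse_toForms (w : ExteriorAlgebra ℝ V) :
    (toForms w).reverse = toForms (CliffordAlgebra.reverse w) := by
  funext k
  ext v
  rw [FockSeq.reverse_apply]
  induction w using ιMulti_induction with
  | smul c w h =>
    rw [map_smul, map_smul, map_smul]
    exact congrArg (c * ·) h
  | add w u h h' =>
    rw [map_add, map_add, map_add]
    exact congrArg₂ (· + ·) h h'
  | ιMulti n x =>
    rw [reverse_ιMulti]
    by_cases hk : k = n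
    · subst hk
      rw [toForms_ιMulti rfl, toForms_ιMulti rfl]
      congr 1
      have h := Matrix.det_submatrix_equiv_self Fin.revPerm
        (Matrix.of fun i j => (inner ℝ (v (Fin.rev j)) (x i) : ℝ))
      refine h.symm.trans (congrArg Matrix.det ?_)
      ext i j
      simp
    · rw [toForms_ιMulti_of_ne hk, toForms_ιMulti_of_ne hk]

theorem toForms_one : toForms (1 : ExteriorAlgebra ℝ V) = FockSeq.one := by
  funext k
  ext v
  rw [toForms_apply]
  rcases k with _ | k
  · rw [interiors_zero, vac_one]; simp [FockSeq.one]
  · rw [interiors_succ, interior_one, map_zero, map_zero, mul_zero]; rfl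

end FermiAlgebra

/-! ### Sums over orthonormal bases -/

namespace FermiAlgebra

open ExteriorAlgebra KreinSpace

variable {V : Type*} [NormedAddCommGroup V] [InnerProductSpace ℝ V]

/-- Parseval's identity in an ON-basis of a Krein space. -/
theorem hasSum_inner_mul_inner [KreinSpace V] {ι : Type*} {ζ : ι → V} (hζ : IsONBasis ζ)
    (x y : V) : HasSum (fun i => inner ℝ (ζ i) x * inner ℝ (ζ i) y) (inner ℝ x y) := by
  let b : HilbertBasis ι ℝ V := HilbertBasis.mk hζ.orthonormal hζ.dense_span.ge
  have hb : ∀ i, b i = ζ i := fun i => by simp [b]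
  refine (b.hasSum_inner_mul_inner x y).congr_fun fun i => ?_
  rw [hb, real_inner_comm]

/-- A sum over multi-indices whose terms are finite sums of products, one factor depending on the
first index and the other on the remaining ones, reduces to the sums of the factors. -/
theorem hasSum_fin_succ {ι κ : Type*} [Fintype κ] {k : ℕ} {f : (Fin (k + 1) → ι) → ℝ}
    {φ : κ → ι → ℝ} {G : κ → (Fin k → ι) → ℝ} {t s : κ → ℝ} (hφ : ∀ j, HasSum (φ j) (t j))
    (hG : ∀ j, HasSum (G j) (s j)) (hf : ∀ z, f z = ∑ j, φ j (z 0) * G j (Fin.tail z)) :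
    HasSum f (∑ j, t j * s j) := by
  rw [← (Fin.consEquiv fun _ : Fin (k + 1) => ι).hasSum_iff]
  have h : ∀ j, HasSum (fun p : ι × (Fin k → ι) => φ j p.1 * G j p.2) (t j * s j) := fun j =>
    (hφ j).mul (hG j) (summable_mul_of_summable_norm (hφ j).summable.norm (hG j).summable.norm)
  refine (hasSum_sum fun j _ => h j).congr_fun fun p => ?_
  rw [Function.comp_apply, hf]
  rfl

/-- Expansion of the arguments of an antisymmetric form in an ON-basis. -/
theorem hasSum_interiors_mul [KreinSpace V] {ι : Type*} {ζ : ι → V} (hζ : IsONBasis ζ) {k : ℕ}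
    (w : ExteriorAlgebra ℝ V) (y : Fin k → V) :
    HasSum (fun z : Fin k → ι => vac (interiors (fun i => ζ (z i)) w) *
      ∏ i, inner ℝ (ζ (z i)) (y i)) (vac (interiors y w)) := by
  induction k generalizing w with
  | zero =>
    simp [interiors_zero]
  | succ k ih =>
    obtain ⟨m, f, g, h⟩ := exists_interior_eq w
    have h1 := hasSum_fin_succ (fun j => hasSum_inner_mul_inner hζ (f j) (y 0))
      (fun j => ih (g j) (Fin.tail y)) (fun z => rfl)
    have e : vac (interiors y w) =
        ∑ j, inner ℝ (f j) (y 0) * vac (interiors (Fin.tail y) (g j)) := by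
      rw [interiors_succ, h]
      simp only [map_sum, map_smul, smul_eq_mul, real_inner_comm]
    rw [e]
    refine h1.congr_fun fun z => ?_
    rw [interiors_succ, h, Fin.prod_univ_succ]
    simp only [map_sum, map_smul, smul_eq_mul, Finset.sum_mul]
    refine Finset.sum_congr rfl fun j _ => ?_
    have e1 : (Fin.tail fun i => ζ (z i)) = fun i => ζ (Fin.tail z i) := rfl
    rw [e1]
    simp only [Fin.tail]
    ring

theorem summable_interiors_sq [KreinSpace V] {ι : Type*} {ζ : ι → V} (hζ : IsONBasis ζ) (k : ℕ)
    (w : ExteriorAlgebra ℝ V) :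
    Summable (fun z : Fin k → ι => vac (interiors (fun i => ζ (z i)) w) ^ 2) := by
  induction k generalizing w with
  | zero => exact Summable.of_finite
  | succ k ih =>
    obtain ⟨m, f, g, h⟩ := exists_interior_eq w
    have h1 := (hasSum_fin_succ (fun j => hasSum_inner_mul_inner hζ (f j) (f j))
      (fun j => (ih (g j)).hasSum) (fun z => rfl)).summable
    refine Summable.of_nonneg_of_le (fun _ => sq_nonneg _) (fun z => ?_) (h1.mul_left (m : ℝ))
    rw [interiors_succ, h]
    simp only [map_sum, map_smul, smul_eq_mul]
    refine (sq_sum_le_card_mul_sum_sq (s := (Finset.univ : Finset (Fin m)))).trans ?_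
    rw [Finset.card_univ, Fintype.card_fin]
    refine mul_le_mul_of_nonneg_left (le_of_eq ?_) (Nat.cast_nonneg _)
    refine Finset.sum_congr rfl fun j _ => ?_
    rw [mul_pow, ← sq]
    rfl

theorem exists_interiors_eq_zero (w : ExteriorAlgebra ℝ V) :
    ∃ N : ℕ, ∀ k ≥ N, ∀ v : Fin k → V, vac (interiors v w) = 0 := by
  induction w using ιMulti_induction with
  | ιMulti n x => exact ⟨n + 1, fun k hk v => vac_interiors_ιMulti_of_ne _ _ _ _ (by omega)⟩
  | smul c w h =>
    obtain ⟨N, h⟩ := h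
    exact ⟨N, fun k hk v => by rw [map_smul, map_smul, h k hk, smul_zero]⟩
  | add w u h h' =>
    obtain ⟨N, h⟩ := h
    obtain ⟨N', h'⟩ := h'
    exact ⟨max N N', fun k hk v => by
      rw [map_add, map_add, h k (le_of_max_le_left hk), h' k (le_of_max_le_right hk), add_zero]⟩

/-- Elements of the exterior algebra represent forms of finite Hilbert-Schmidt norm. -/
theorem toForms_mem [KreinSpace V] (w : ExteriorAlgebra ℝ V) : toForms w ∈ fockSubmodule V := by
  change Memℓp (fockCoord (toForms w)) 2
  rw [memℓp_gen_iff (by simp)]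
  simp only [ENNReal.toReal_ofNat, Real.rpow_ofNat, Real.norm_eq_abs, sq_abs]
  rw [summable_sigma_of_nonneg fun _ => sq_nonneg _]
  refine ⟨fun n => ?_, ?_⟩
  · refine ((summable_interiors_sq (isONBasis_onBasis V) n w).mul_left
      ((√(n.factorial : ℝ) * (n.factorial : ℝ)⁻¹) ^ 2)).congr fun z => ?_
    rw [fockCoord, toForms_apply, ← mul_assoc, ← mul_pow]
  · obtain ⟨N, hN⟩ := exists_interiors_eq_zero w
    refine summable_of_ne_finset_zero (s := Finset.range N) fun n hn => ?_
    have : ∀ z : Fin n → onBasis V, fockCoord (toForms w) ⟨n, z⟩ ^ 2 = 0 := fun z => by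
      rw [fockCoord, toForms_apply, hN n (by simpa using hn), mul_zero, mul_zero]; simp
    simp only [this, tsum_zero]

/-! ### The Gaussian functional -/

/-- The recursion step that defines `contraction`: its value on `(w, C w)` is `C (x ∧ w)`. The
factor `2` counts the two orders in which the double interior product can hit `x`. -/
noncomputable def contractionStep (h : V →ₗ[ℝ] V) :
    V →ₗ[ℝ] ExteriorAlgebra ℝ V × ExteriorAlgebra ℝ V →ₗ[ℝ] ExteriorAlgebra ℝ V :=
  ((2 : ℝ) • interior.comp h).compl₂ (LinearMap.fst ℝ _ _) +
    ((Algebra.lmul ℝ (ExteriorAlgebra ℝ V)).toLinearMap.comp (ι ℝ)).compl₂ (LinearMap.snd ℝ _ _)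

theorem contractionStep_apply (h : V →ₗ[ℝ] V) (x : V) (w w' : ExteriorAlgebra ℝ V) :
    contractionStep h x (w, w') = (2 : ℝ) • interior (h x) w + ι ℝ x * w' := rfl

theorem contractionStep_contractionStep (h : V →ₗ[ℝ] V) (hh : ∀ x, inner ℝ (h x) x = (0 : ℝ))
    (x : V) (w w' : ExteriorAlgebra ℝ V) :
    contractionStep h x (ι ℝ x * w, contractionStep h x (w, w')) =
      (0 : QuadraticForm ℝ V) x • w' := by
  rw [contractionStep_apply, contractionStep_apply, interior_ι_mul, hh, mul_add, ← mul_assoc,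
    ι_sq_zero, mul_smul_comm]
  simp

/-- The second order operator `∑ᵢ ψᵢ ⌟ (φᵢ ⌟ ·)` for the antisymmetric tensor `∑ᵢ φᵢ ⊗ ψᵢ` that
corresponds to an antisymmetric operator `h`. In infinite dimensions this tensor is an infinite sum,
so the operator is defined by recursion on products of vectors instead. -/
noncomputable def contraction (h : V →ₗ[ℝ] V) (hh : ∀ x, inner ℝ (h x) x = (0 : ℝ)) :
    ExteriorAlgebra ℝ V →ₗ[ℝ] ExteriorAlgebra ℝ V :=
  CliffordAlgebra.foldr' (0 : QuadraticForm ℝ V) (contractionStep h)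
    (contractionStep_contractionStep h hh) 0

section Gauss

variable (h : V →ₗ[ℝ] V) (hh : ∀ x, inner ℝ (h x) x = (0 : ℝ))

theorem contraction_one : contraction h hh 1 = 0 := by
  have := CliffordAlgebra.foldr'_algebraMap (0 : QuadraticForm ℝ V) (contractionStep h)
    (contractionStep_contractionStep h hh) 0 1
  rw [map_one, smul_zero] at this
  exact this

theorem contraction_ι_mul (x : V) (w : ExteriorAlgebra ℝ V) :
    contraction h hh (ι ℝ x * w) =
      (2 : ℝ) • interior (h x) w + ι ℝ x * contraction h hh w :=
  CliffordAlgebra.foldr'_ι_mul _ _ _ _ _ _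

theorem interior_contraction (v : V) (w : ExteriorAlgebra ℝ V) :
    interior v (contraction h hh w) = contraction h hh (interior v w) := by
  induction w using left_induction with
  | one => rw [contraction_one, interior_one, map_zero, map_zero]
  | smul c w ih => simp only [map_smul, ih]
  | add w u ih ih' => simp only [map_add, ih, ih']
  | ι_mul x w ih =>
    rw [contraction_ι_mul, interior_ι_mul, map_add, map_smul, interior_ι_mul, map_sub, map_smul,
      contraction_ι_mul, ih, interior_comm v]
    simp only [smul_neg]
    abel

theorem interior_contraction_pow (n : ℕ) (v : V) (w : ExteriorAlgebra ℝ V) :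
    interior v ((contraction h hh ^ n) w) = (contraction h hh ^ n) (interior v w) := by
  induction n with
  | zero => rfl
  | succ n ih =>
    rw [pow_succ', Module.End.mul_apply, interior_contraction, ih, Module.End.mul_apply]

theorem contraction_pow_ι_mul (n : ℕ) (x : V) (w : ExteriorAlgebra ℝ V) :
    (contraction h hh ^ (n + 1)) (ι ℝ x * w) = ι ℝ x * (contraction h hh ^ (n + 1)) w +
      (2 * (n + 1) : ℝ) • (contraction h hh ^ n) (interior (h x) w) := by
  induction n with
  | zero => simp [contraction_ι_mul, add_comm]
  | succ n ih =>
    have e : ∀ k (u : ExteriorAlgebra ℝ V), (contraction h hh ^ (k + 1)) u =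
        contraction h hh ((contraction h hh ^ k) u) := fun k u => by
      rw [pow_succ', Module.End.mul_apply]
    rw [e (n + 1), ih, map_add, contraction_ι_mul, map_smul, interior_contraction_pow, ← e, ← e]
    push_cast
    module

theorem exists_contraction_pow_eq_zero (w : ExteriorAlgebra ℝ V) :
    ∃ N : ℕ, ∀ n ≥ N, (contraction h hh ^ n) w = 0 := by
  induction w using left_induction with
  | one =>
    refine ⟨1, fun n hn => ?_⟩
    obtain ⟨n, rfl⟩ := Nat.exists_eq_add_of_le' hn
    rw [pow_succ, Module.End.mul_apply, contraction_one, map_zero]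
  | smul c w ih =>
    obtain ⟨N, ih⟩ := ih
    exact ⟨N, fun n hn => by rw [map_smul, ih n hn, smul_zero]⟩
  | add w u ih ih' =>
    obtain ⟨N, ih⟩ := ih
    obtain ⟨N', ih'⟩ := ih'
    exact ⟨max N N', fun n hn => by
      rw [map_add, ih n (le_of_max_le_left hn), ih' n (le_of_max_le_right hn), add_zero]⟩
  | ι_mul x w ih =>
    obtain ⟨N, ih⟩ := ih
    refine ⟨N + 1, fun n hn => ?_⟩
    obtain ⟨n, rfl⟩ := Nat.exists_eq_add_of_le' (by omega : 1 ≤ n)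
    rw [contraction_pow_ι_mul, ih _ (by omega), ← interior_contraction_pow, ih _ (by omega)]
    simp

theorem summable_gauss (w : ExteriorAlgebra ℝ V) :
    Summable fun n : ℕ => (-1) ^ n / (2 ^ n * n.factorial : ℝ) *
      vac ((contraction h hh ^ n) w) := by
  obtain ⟨N, hN⟩ := exists_contraction_pow_eq_zero h hh w
  refine summable_of_ne_finset_zero (s := Finset.range N) fun n hn => ?_
  rw [hN n (by simpa using hn), map_zero, mul_zero]

/-- The Gaussian functional `w ↦ ⟨exp (-½ ∑ᵢ ψᵢ ⌟ (φᵢ ⌟ ·)) w⟩₀` with covariance determined by the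
antisymmetric operator `h`. The exponential series is finite on every element. -/
noncomputable def gauss : ExteriorAlgebra ℝ V →ₗ[ℝ] ℝ where
  toFun w := ∑' n : ℕ, (-1) ^ n / (2 ^ n * n.factorial : ℝ) * vac ((contraction h hh ^ n) w)
  map_add' w w' := by
    rw [← (summable_gauss h hh w).tsum_add (summable_gauss h hh w')]
    simp only [map_add, mul_add]
  map_smul' c w := by
    rw [RingHom.id_apply, smul_eq_mul, ← tsum_mul_left]
    simp only [map_smul, smul_eq_mul, mul_left_comm]

theorem hasSum_gauss (w : ExteriorAlgebra ℝ V) :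
    HasSum (fun n : ℕ => (-1) ^ n / (2 ^ n * n.factorial : ℝ) *
      vac ((contraction h hh ^ n) w)) (gauss h hh w) := (summable_gauss h hh w).hasSum

theorem gauss_one : gauss h hh 1 = 1 := by
  refine (hasSum_gauss h hh 1).unique ?_
  have h1 := hasSum_single (f := fun n : ℕ => (-1) ^ n / (2 ^ n * n.factorial : ℝ) *
    vac ((contraction h hh ^ n) 1)) 0 fun n hn => by
      obtain ⟨n, rfl⟩ := Nat.exists_eq_succ_of_ne_zero hn
      rw [Nat.succ_eq_add_one, pow_succ (contraction h hh), Module.End.mul_apply, contraction_one,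
        map_zero, map_zero, mul_zero]
  simpa [vac_one] using h1

/-- Integration by parts for the Gaussian functional. -/
theorem gauss_ι_mul (x : V) (w : ExteriorAlgebra ℝ V) :
    gauss h hh (ι ℝ x * w) = -gauss h hh (interior (h x) w) := by
  change (∑' n : ℕ, _) = -∑' n : ℕ, _
  rw [(summable_gauss h hh _).tsum_eq_zero_add, pow_zero (contraction h hh),
    Module.End.one_apply, vac_ι_mul, mul_zero, zero_add, ← tsum_neg]
  refine tsum_congr fun n => ?_
  rw [contraction_pow_ι_mul, map_add, vac_ι_mul, zero_add, map_smul, smul_eq_mul, ← mul_assoc,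
    ← neg_mul]
  congr 1
  rw [Nat.factorial_succ]
  push_cast
  have : (n.factorial : ℝ) ≠ 0 := by exact_mod_cast n.factorial_ne_zero
  have : (n + 1 : ℝ) ≠ 0 := by positivity
  field_simp
  ring

end Gauss

end FermiAlgebra

/-! ### The probability map as a Gaussian functional -/

namespace FermiAlgebra

open ExteriorAlgebra KreinSpace

section Contraction

variable {V : Type*} [NormedAddCommGroup V] [InnerProductSpace ℝ V]

/-- Two successive interior products have finite rank, and applying the antisymmetric form
`⟪h ·, ·⟫` to the coefficients gives `contraction h`. -/
theorem exists_interior_interior_eq (h : V →ₗ[ℝ] V) (hh : ∀ x, inner ℝ (h x) x = (0 : ℝ))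
    (w : ExteriorAlgebra ℝ V) :
    ∃ (κ : Type) (_ : Fintype κ) (φ ψ : κ → V) (g : κ → ExteriorAlgebra ℝ V),
      (∀ a b, interior b (interior a w) = ∑ j, (inner ℝ a (φ j) * inner ℝ b (ψ j)) • g j) ∧
      contraction h hh w = ∑ j, (inner ℝ (h (φ j)) (ψ j) : ℝ) • g j := by
  have hanti : ∀ x y, inner ℝ (h x) y = -(inner ℝ (h y) x : ℝ) := fun x y => by
    have := hh (x + y)
    rw [map_add, inner_add_left, inner_add_right, inner_add_right, hh, hh] at this
    linarith
  induction w using left_induction with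
  | one =>
    exact ⟨Empty, inferInstance, Empty.elim, Empty.elim, Empty.elim, fun a b => by
      simp [interior_one], by simp [contraction_one]⟩
  | smul c w ih =>
    obtain ⟨κ, _, φ, ψ, g, h1, h2⟩ := ih
    exact ⟨κ, inferInstance, φ, ψ, fun j => c • g j, fun a b => by
      simp only [map_smul, h1, Finset.smul_sum, smul_comm c], by
      simp only [map_smul, h2, Finset.smul_sum, smul_comm c]⟩
  | add w u ih ih' =>
    obtain ⟨κ, _, φ, ψ, g, h1, h2⟩ := ih
    obtain ⟨κ', _, φ', ψ', g', h1', h2'⟩ := ih'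
    exact ⟨κ ⊕ κ', inferInstance, Sum.elim φ φ', Sum.elim ψ ψ', Sum.elim g g', fun a b => by
      simp [h1, h1'], by simp [h2, h2']⟩
  | ι_mul y w ih =>
    obtain ⟨κ, _, φ, ψ, g, h1, h2⟩ := ih
    obtain ⟨m, f, e, h3⟩ := exists_interior_eq w
    refine ⟨Fin m ⊕ Fin m ⊕ κ, inferInstance, Sum.elim (fun _ => y) (Sum.elim f φ),
      Sum.elim f (Sum.elim (fun _ => y) ψ),
      Sum.elim e (Sum.elim (fun j => -e j) fun j => ι ℝ y * g j), fun a b => ?_, ?_⟩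
    · rw [interior_ι_mul, map_sub, map_smul, interior_ι_mul, h1, h3, h3]
      simp only [Fintype.sum_sum_type, Sum.elim_inl, Sum.elim_inr, Finset.mul_sum, Finset.smul_sum,
        mul_smul_comm, smul_smul, smul_neg, Finset.sum_neg_distrib]
      rw [sub_sub_eq_add_sub, add_sub_assoc, sub_eq_add_neg, add_comm (Finset.sum _ _) (-_)]
      simp only [mul_comm (inner ℝ b y : ℝ)]
    · rw [contraction_ι_mul, h2, h3]
      simp only [Fintype.sum_sum_type, Sum.elim_inl, Sum.elim_inr, Finset.mul_sum, mul_smul_comm,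
        smul_neg, ← neg_smul, ← hanti, two_smul, ← add_assoc]

theorem interiors_snoc {k : ℕ} (v : Fin k → V) (x : V) (w : ExteriorAlgebra ℝ V) :
    interiors (Fin.snoc (α := fun _ => V) v x) w = interior x (interiors v w) := by
  induction k generalizing w with
  | zero => rfl
  | succ k ih =>
    have h : Fin.snoc (α := fun _ => V) v x =
        Fin.cons (α := fun _ => V) (v 0) (Fin.snoc (α := fun _ => V) (Fin.tail v) x) := by
      rw [Fin.cons_snoc_eq_snoc_cons, Fin.cons_self_tail]
    rw [h, interiors_succ, Fin.tail_cons, Fin.cons_zero, ih, ← interiors_succ]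

theorem interior_interiors {k : ℕ} (v : Fin k → V) (x : V) (w : ExteriorAlgebra ℝ V) :
    interior x (interiors v w) = (-1 : ℝ) ^ k • interiors v (interior x w) := by
  induction k generalizing w with
  | zero => simp [interiors_zero]
  | succ k ih =>
    rw [interiors_succ, interiors_succ, ih, interior_comm, map_neg, pow_succ]
    simp

/-- The nested arguments `z₁, …, zₙ, u zₙ, …, u z₁` of the probability map may be taken pairwise:
the pair `z₁`, `u z₁` encloses an even number of arguments, so that no sign arises. -/
theorem interiors_probArgs (u : V →ₗ[ℝ] V) {n : ℕ} (z : Fin (n + 1) → V)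
    (w : ExteriorAlgebra ℝ V) :
    interiors (probArgs u z) w =
      interiors (probArgs u (Fin.tail z)) (interior (u (z 0)) (interior (z 0) w)) := by
  have h1 : Fin.tail (n := 2 * n + 1) (α := fun _ => V) (probArgs u z) =
      Fin.snoc (α := fun _ => V) (probArgs u (Fin.tail z)) (u (z 0)) := by
    ext i
    refine Fin.lastCases ?_ (fun i => ?_) i
    · rw [Fin.snoc_last, Fin.tail, probArgs, dif_neg (by simp; omega)]
      congr 2
      exact Fin.ext (by simp; omega)
    · rw [Fin.snoc_castSucc, Fin.tail, probArgs, probArgs]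
      by_cases hi : (i : ℕ) < n
      · rw [dif_pos (by simp; omega), dif_pos hi]
        rfl
      · rw [dif_neg (by simp; omega), dif_neg hi]
        congr 2
        exact Fin.ext (by simp; omega)
  have h2 : probArgs u z (0 : Fin (2 * n + 1 + 1)) = z 0 := by
    simp [probArgs]
  change interiors (Fin.tail (n := 2 * n + 1) (α := fun _ => V) (probArgs u z))
    (interior (probArgs u z (0 : Fin (2 * n + 1 + 1))) w) = _
  rw [h1, h2, interiors_snoc, interior_interiors, pow_mul]
  simp

end Contraction

section Prob

variable {V : Type*} [NormedAddCommGroup V] [InnerProductSpace ℝ V] [KreinSpace V]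

/-- The sums over ON-bases in the probability map are vacuum values of powers of `contraction`. -/
theorem hasSum_probTerm {ι' : Type*} {ζ : ι' → V} (hζ : IsONBasis ζ) (u : V →ₗ[ℝ] V)
    (hu : ∀ x y, inner ℝ (u x) y = (inner ℝ x (u y) : ℝ))
    (hh : ∀ x, inner ℝ ((u.comp sym.toLinearMap) x) x = (0 : ℝ)) (n : ℕ)
    (w : ExteriorAlgebra ℝ V) :
    HasSum (fun z : Fin n → ι' => (-1 : ℝ) ^ (∑ k, sig (ζ (z k))) *
      vac (interiors (probArgs u fun k => ζ (z k)) w))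
      (vac ((contraction (u.comp sym.toLinearMap) hh ^ n) w)) := by
  induction n generalizing w with
  | zero => simp [interiors_zero]
  | succ n ih =>
    obtain ⟨κ, _, φ, ψ, g, h1, h2⟩ := exists_interior_interior_eq _ hh w
    -- The signs `(-1)^[ζᵢ]` turn `u` into `u ∘ sym`.
    have hs : ∀ x y, HasSum
        (fun i => (-1 : ℝ) ^ sig (ζ i) * (inner ℝ (ζ i) x * inner ℝ (u (ζ i)) y))
        (inner ℝ (u (sym x)) y) := fun x y => by
      rw [hu]
      refine (hasSum_inner_mul_inner hζ (sym x) (u y)).congr_fun fun i => ?_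
      rw [← inner_sym_left, hζ.sym_eq, inner_smul_left, hu]
      simp [mul_assoc]
    have h3 := hasSum_fin_succ (fun j => hs (φ j) (ψ j)) (fun j => ih (g j)) (fun z => rfl)
    rw [pow_succ, Module.End.mul_apply, h2]
    simp only [map_sum, map_smul, smul_eq_mul]
    refine h3.congr_fun fun z => ?_
    rw [interiors_probArgs, h1, Fin.sum_univ_succ, pow_add]
    simp only [map_sum, map_smul, smul_eq_mul, Finset.mul_sum]
    refine Finset.sum_congr rfl fun j _ => ?_
    have e1 : (Fin.tail fun i => ζ (z i)) = fun i => ζ (Fin.tail z i) := rfl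
    rw [e1]
    simp only [Fin.tail]
    ring

/-- On forms represented by the exterior algebra the sums defining the probability map converge
to the Gaussian functional. -/
theorem hasProb_toForms (u : V →ₗ[ℝ] V) (hu : ∀ x y, inner ℝ (u x) y = (inner ℝ x (u y) : ℝ))
    (hh : ∀ x, inner ℝ ((u.comp sym.toLinearMap) x) x = (0 : ℝ)) (w : ExteriorAlgebra ℝ V) :
    HasProb u (toForms w) (gauss (u.comp sym.toLinearMap) hh w) := by
  refine ⟨_, fun n B hB => ?_, hasSum_gauss _ hh w⟩
  refine ((hasSum_probTerm hB u hu hh n w).mul_left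
    ((-1) ^ n / (2 ^ n * n.factorial : ℝ))).congr_fun fun z => ?_
  rw [probTerm, toForms_apply]
  have : ((2 * n).factorial : ℝ) ≠ 0 := by exact_mod_cast (2 * n).factorial_ne_zero
  field_simp

theorem HasProb.unique {u : V →ₗ[ℝ] V} {σ : FockSeq V} {a b : ℝ} (ha : HasProb u σ a)
    (hb : HasProb u σ b) : a = b := by
  obtain ⟨s, hs, ha⟩ := ha
  obtain ⟨t, ht, hb⟩ := hb
  have : s = t := funext fun n => (hs n _ (isONBasis_onBasis V)).unique
    (ht n _ (isONBasis_onBasis V))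
  exact ha.unique (this ▸ hb)

theorem probMap_toForms (u : V →ₗ[ℝ] V) (hu : ∀ x y, inner ℝ (u x) y = (inner ℝ x (u y) : ℝ))
    (hh : ∀ x, inner ℝ ((u.comp sym.toLinearMap) x) x = (0 : ℝ)) (w : ExteriorAlgebra ℝ V) :
    probMap u (toForms w) = gauss (u.comp sym.toLinearMap) hh w := by
  have h : ∃ a, HasProb u (toForms w) a := ⟨_, hasProb_toForms u hu hh w⟩
  rw [probMap, dif_pos h]
  exact HasProb.unique h.choose_spec (hasProb_toForms u hu hh w)

end Prob

section Reversal

variable {V : Type*} [NormedAddCommGroup V] [InnerProductSpace ℝ V] [KreinSpace V]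
  {N : Submodule ℝ V} (hN : IsHypermaximalNeutral N)

theorem reversal_reversal (x : V) : reversal N hN (reversal N hN x) = x :=
  (existsUnique_reversal N hN).choose_spec.1.1 x

theorem reversal_of_mem {x : V} (hx : x ∈ N) : reversal N hN x = x :=
  (existsUnique_reversal N hN).choose_spec.1.2.2 x hx

theorem sym_reversal (x : V) : sym (reversal N hN x) = -reversal N hN (sym x) := by
  obtain ⟨h1, h2, -⟩ := (existsUnique_reversal N hN).choose_spec.1.2.1
  change ∀ x, sym x = x → sym (reversal N hN x) = -reversal N hN x at h1
  change ∀ x, sym x = -x → sym (reversal N hN x) = reversal N hN x at h2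
  have k1 := h1 (x + sym x) (by rw [map_add, sym_sym, add_comm])
  have k2 := h2 (x - sym x) (by rw [map_sub, sym_sym]; abel)
  simp only [map_add, map_sub] at k1 k2
  have k3 : (2 : ℝ) • sym (reversal N hN x) = (2 : ℝ) • (-reversal N hN (sym x)) := by
    rw [two_smul, two_smul]
    calc sym (reversal N hN x) + sym (reversal N hN x)
        = (sym (reversal N hN x) + sym (reversal N hN (sym x))) +
          (sym (reversal N hN x) - sym (reversal N hN (sym x))) := by abel
      _ = _ := by rw [k1, k2]; abel
  exact smul_right_injective V (two_ne_zero' ℝ) k3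

theorem inner_reversal_left (x y : V) :
    inner ℝ (reversal N hN x) y = (inner ℝ x (reversal N hN y) : ℝ) := by
  have h := (existsUnique_reversal N hN).choose_spec.1.2.1.2.2 (sym x) (reversal N hN y)
  change kreinForm (reversal N hN (sym x)) (reversal N hN (reversal N hN y)) = _ at h
  rw [reversal_reversal, kreinForm, kreinForm, sym_reversal, sym_sym, inner_neg_left] at h
  exact neg_injective h

theorem inner_reversal_sym_self (x : V) :
    inner ℝ (((reversal N hN).comp sym.toLinearMap) x) x = (0 : ℝ) := by
  have h1 : inner ℝ (reversal N hN (sym x)) x = (inner ℝ (sym x) (reversal N hN x) : ℝ) :=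
    inner_reversal_left hN _ _
  have h2 : inner ℝ (sym x) (reversal N hN x) = -(inner ℝ x (reversal N hN (sym x)) : ℝ) := by
    rw [inner_sym_left, sym_reversal, inner_neg_right]
  change inner ℝ (reversal N hN (sym x)) x = (0 : ℝ)
  rw [real_inner_comm (reversal N hN (sym x)) x] at h2
  linarith

/-- The reversal fixes nothing outside `N`. -/
theorem mem_of_reversal_eq {x : V} (hx : reversal N hN x = x) : x ∈ N := by
  refine (hN x).2 fun y hy => ?_
  have h1 : inner ℝ (sym x) y = (inner ℝ (sym x) (reversal N hN y) : ℝ) := by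
    rw [reversal_of_mem hN hy]
  have h2 : reversal N hN (sym x) = -sym x := by
    have := sym_reversal hN x
    rw [hx] at this
    exact (neg_eq_iff_eq_neg.mpr this).symm
  rw [← inner_reversal_left, h2, inner_neg_left] at h1
  rw [kreinForm]
  linarith

end Reversal

end FermiAlgebra

/-! ### Truncations of the Fock space -/

namespace FermiAlgebra

open ExteriorAlgebra KreinSpace

section Lists

variable {V : Type*} [NormedAddCommGroup V] [InnerProductSpace ℝ V]

theorem list_prod_ι (l : List V) : (l.map (ι ℝ)).prod = ιMulti ℝ l.length l.get := by
  rw [ιMulti_apply]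
  congr 1
  exact List.ext_getElem (by simp) fun i h1 h2 => by simp

/-- The expansion of an element of the exterior algebra in the products of the sublists of `L`, with
the coefficients appropriate for an orthonormal `L`. -/
noncomputable def expand (L : List V) (w : ExteriorAlgebra ℝ V) : ExteriorAlgebra ℝ V :=
  (L.sublists'.map fun l => vac (interiors l.get w) • (l.map (ι ℝ)).prod).sum

theorem expand_nil (w : ExteriorAlgebra ℝ V) : expand [] w = vac w • 1 := by
  simp [expand]
  rfl

theorem expand_cons (a : V) (L : List V) (w : ExteriorAlgebra ℝ V) :
    expand (a :: L) w = expand L w + ι ℝ a * expand L (interior a w) := by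
  have h : ∀ l : List V, interiors (a :: l).get w = interiors l.get (interior a w) := fun l => rfl
  simp only [expand, List.sublists'_cons, List.map_append, List.sum_append, List.map_map]
  congr 1
  rw [← List.sum_map_mul_left]
  congr 2
  funext l
  simp only [Function.comp_apply, List.map_cons, List.prod_cons, mul_smul_comm]
  rw [← h]

theorem expand_add (L : List V) (w w' : ExteriorAlgebra ℝ V) :
    expand L (w + w') = expand L w + expand L w' := by
  simp only [expand, map_add, add_smul, List.sum_map_add]

theorem expand_smul (L : List V) (c : ℝ) (w : ExteriorAlgebra ℝ V) :
    expand L (c • w) = c • expand L w := by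
  simp only [expand, map_smul, smul_assoc, List.smul_sum, List.map_map]
  rfl

theorem expand_one (L : List V) : expand L 1 = 1 := by
  induction L with
  | nil => rw [expand_nil, vac_one, one_smul]
  | cons a L ih =>
    have h0 : expand L 0 = 0 := by simpa using expand_smul L 0 0
    rw [expand_cons, ih, interior_one, h0, mul_zero, add_zero]

theorem expand_ι_mul_of_orthogonal (L : List V) (y : V) (hy : ∀ x ∈ L, inner ℝ x y = (0 : ℝ))
    (w : ExteriorAlgebra ℝ V) : expand L (ι ℝ y * w) = 0 := by
  induction L generalizing w with
  | nil => rw [expand_nil, vac_ι_mul, zero_smul]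
  | cons a L ih =>
    have hL : ∀ x ∈ L, inner ℝ x y = (0 : ℝ) := fun x hx => hy x (List.mem_cons_of_mem _ hx)
    rw [expand_cons, ih hL, interior_ι_mul, hy a List.mem_cons_self, zero_smul, zero_sub,
      ← neg_one_smul ℝ, expand_smul, ih hL]
    simp

theorem expand_ι_mul (L : List V) (h1 : ∀ x ∈ L, inner ℝ x x = (1 : ℝ))
    (h2 : L.Pairwise fun x y => inner ℝ x y = (0 : ℝ)) {y : V} (hy : y ∈ L)
    (w : ExteriorAlgebra ℝ V) : expand L (ι ℝ y * w) = ι ℝ y * expand L w := by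
  induction L generalizing w with
  | nil => simp at hy
  | cons a L ih =>
    rw [List.pairwise_cons] at h2
    have e : ∀ (c : ℝ) (u : ExteriorAlgebra ℝ V),
        expand L (c • w - u) = c • expand L w - expand L u := fun c u => by
      rw [sub_eq_add_neg, expand_add, expand_smul, ← neg_one_smul ℝ u, expand_smul,
        neg_one_smul, sub_eq_add_neg]
    rw [expand_cons, expand_cons, interior_ι_mul, e]
    rcases List.mem_cons.1 hy with rfl | hy
    · have h3 : ∀ x ∈ L, inner ℝ x y = (0 : ℝ) := fun x hx => by
        rw [real_inner_comm]; exact h2.1 x hx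
      rw [expand_ι_mul_of_orthogonal L y h3, expand_ι_mul_of_orthogonal L y h3,
        h1 y List.mem_cons_self, mul_add, ← mul_assoc, ι_sq_zero]
      simp
    · have h3 := fun u => ih (fun x hx => h1 x (List.mem_cons_of_mem _ hx)) h2.2 hy u
      rw [h3, h3, h2.1 y hy, zero_smul, zero_sub, mul_neg, mul_add, ← mul_assoc, ← mul_assoc,
        ι_mul_ι_comm y a, neg_mul]

end Lists

section Frame

variable {V : Type*} [NormedAddCommGroup V] [InnerProductSpace ℝ V] [KreinSpace V]

/-- An orthonormal basis, in the positive definite inner product, of a finite dimensional Krein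
subspace, as a list. -/
noncomputable def frame (γ : FinKrein V) : List V :=
  haveI := γ.2.1
  List.ofFn fun i => (stdOrthonormalBasis ℝ γ.1 i : V)

theorem inner_frame_self (γ : FinKrein V) : ∀ x ∈ frame γ, inner ℝ x x = (1 : ℝ) := by
  have := γ.2.1
  intro x hx
  obtain ⟨i, rfl⟩ := List.mem_ofFn.1 hx
  rw [← Submodule.coe_inner, real_inner_self_eq_norm_sq,
    (stdOrthonormalBasis ℝ γ.1).norm_eq_one, one_pow]

theorem pairwise_frame (γ : FinKrein V) :
    (frame γ).Pairwise fun x y => inner ℝ x y = (0 : ℝ) := by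
  have := γ.2.1
  rw [frame, List.pairwise_ofFn]
  intro i j hij
  rw [← Submodule.coe_inner]
  exact (stdOrthonormalBasis ℝ γ.1).orthonormal.2 hij.ne

theorem mem_of_mem_frame (γ : FinKrein V) {x : V} (hx : x ∈ frame γ) : x ∈ γ.1 := by
  have := γ.2.1
  obtain ⟨i, rfl⟩ := List.mem_ofFn.1 hx
  exact Subtype.property _

theorem sum_frame (γ : FinKrein V) {v : V} (hv : v ∈ γ.1) :
    ((frame γ).map fun x => (inner ℝ x v : ℝ) • x).sum = v := by
  have := γ.2.1
  have h := (stdOrthonormalBasis ℝ γ.1).sum_repr' ⟨v, hv⟩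
  have h2 := congrArg Subtype.val h
  rw [frame, List.map_ofFn, List.sum_ofFn]
  simpa using h2

/-- The monomials of an ON-basis of `γ` expand the exterior algebra of `γ`. -/
theorem expand_frame (γ : FinKrein V) (w : ExteriorAlgebra ℝ γ.1) :
    expand (frame γ) (map γ.1.subtype w) = map γ.1.subtype w := by
  induction w using left_induction with
  | one => rw [map_one, expand_one]
  | smul c w h => rw [map_smul, expand_smul, h]
  | add w u h h' => rw [map_add, expand_add, h, h']
  | ι_mul y w h =>
    rw [map_mul, map_apply_ι]
    have key : ∀ x ∈ Submodule.span ℝ {x | x ∈ frame γ},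
        expand (frame γ) (ι ℝ x * map γ.1.subtype w) = ι ℝ x * map γ.1.subtype w := by
      intro x hx
      induction hx using Submodule.span_induction with
      | mem x hx => rw [expand_ι_mul _ (inner_frame_self γ) (pairwise_frame γ) hx, h]
      | zero => simpa using expand_smul (frame γ) 0 0
      | add x y _ _ hx hy => rw [map_add, add_mul, expand_add, hx, hy]
      | smul c x _ hx => rw [map_smul, smul_mul_assoc, expand_smul, hx]
    refine key _ ?_
    change (y : V) ∈ _
    rw [← sum_frame γ y.2]
    refine list_sum_mem fun x hx => ?_
    obtain ⟨z, hz, rfl⟩ := List.mem_map.1 hx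
    exact Submodule.smul_mem _ _ (Submodule.subset_span hz)

theorem starProjection_sym {H : Type*} [NormedAddCommGroup H] [InnerProductSpace ℝ H] [KreinSpace H]
    (K : Submodule ℝ H) [K.HasOrthogonalProjection] (hK : ∀ x ∈ K, sym x ∈ K) (x : H) :
    K.starProjection (sym x) = sym (K.starProjection x) := by
  refine Submodule.eq_starProjection_of_mem_of_inner_eq_zero
    (hK _ (K.starProjection_apply_mem x)) fun y hy => ?_
  rw [← map_sub, inner_sym_left]
  exact K.starProjection_inner_eq_zero x _ (hK y hy)

theorem proj_sym (γ : FinKrein V) (x : V) : γ.proj (sym x) = sym (γ.proj x) :=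
  haveI := γ.2.1
  starProjection_sym γ.1 γ.2.2 x

theorem inner_proj (γ : FinKrein V) (x v : V) :
    inner ℝ v (γ.proj x) = (inner ℝ (γ.proj v) x : ℝ) :=
  haveI := γ.2.1
  (γ.1.inner_starProjection_left_eq_right v x).symm

theorem proj_of_mem (γ : FinKrein V) {x : V} (hx : x ∈ γ.1) : γ.proj x = x :=
  haveI := γ.2.1
  Submodule.starProjection_eq_self_iff.2 hx

theorem proj_mem (γ : FinKrein V) (x : V) : γ.proj x ∈ γ.1 :=
  haveI := γ.2.1
  γ.1.starProjection_apply_mem x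

theorem sym_mem_truncation (γ : FinKrein V) {ξ : Fock V} (hξ : ξ ∈ truncation γ) :
    sym ξ ∈ truncation γ := by
  have hs : ∀ n (x : Fin n → V), ξ.seq n (fun k => γ.proj (x k)) = ξ.seq n x := fun n x =>
    congrArg (fun g : FockSeq V => g n x) hξ
  refine funext fun n => ContinuousAlternatingMap.ext fun x => ?_
  change ξ.seq n (fun k => sym (γ.proj (x k))) = ξ.seq n fun k => sym (x k)
  rw [← hs n fun k => sym (x k)]
  simp only [proj_sym]

/-- The element of the Fock space represented by an element of the exterior algebra. -/
noncomputable def toFock : ExteriorAlgebra ℝ V →ₗ[ℝ] Fock V :=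
  LinearMap.codRestrict (fockSubmodule V) toForms toForms_mem

theorem seq_toFock (w : ExteriorAlgebra ℝ V) : (toFock w).seq = toForms w := rfl

theorem toFock_mem_truncation (γ : FinKrein V) (w : ExteriorAlgebra ℝ γ.1) :
    toFock (map γ.1.subtype w) ∈ truncation γ := by
  change FockSeq.pullback γ.proj (toForms _) = toForms _
  rw [pullback_toForms γ.proj.toLinearMap γ.proj (inner_proj γ)]
  congr 1
  have h : γ.proj.toLinearMap ∘ₗ γ.1.subtype = γ.1.subtype :=
    LinearMap.ext fun x => proj_of_mem γ x.2
  rw [← AlgHom.comp_apply, map_comp_map, h]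

theorem sign_mul_sign_mul {α : Type*} [Fintype α] [DecidableEq α] (π : Equiv.Perm α) (r : ℝ) :
    ((Equiv.Perm.sign π : ℤ) : ℝ) * (((Equiv.Perm.sign π : ℤ) : ℝ) * r) = r := by
  rcases Int.units_eq_one_or (Equiv.Perm.sign π) with h | h <;> simp [h]

/-- Forms that factor through a finite dimensional Krein subspace are represented by its exterior
algebra. -/
theorem exists_toForms_eq (γ : FinKrein V) (a : FockSeq V)
    (ha : FockSeq.pullback γ.proj a = a) :
    ∃ w : ExteriorAlgebra ℝ γ.1, toForms (map γ.1.subtype w) = a := by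
  have := γ.2.1
  let b := stdOrthonormalBasis ℝ γ.1
  have hs : ∀ n (x : Fin n → V), a n (fun k => γ.proj (x k)) = a n x := fun n x =>
    congrArg (fun g : FockSeq V => g n x) ha
  have hproj : ∀ v, γ.proj v = ∑ i, (inner ℝ (b i : V) v : ℝ) • (b i : V) := fun v => by
    have h := congrArg Subtype.val (b.sum_repr' ⟨γ.proj v, proj_mem γ v⟩)
    refine h.symm.trans ?_
    simp only [Submodule.coe_sum, Submodule.coe_smul, Submodule.coe_inner]
    refine Finset.sum_congr rfl fun i _ => ?_
    rw [inner_proj, proj_of_mem γ (b i).2]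
  -- expansion of the arguments in an ON-basis of `γ`
  have hexp : ∀ n (v : Fin n → V), a n v =
      ∑ J : Fin n → Fin (Module.finrank ℝ γ.1), (∏ k, inner ℝ (b (J k) : V) (v k)) *
        a n fun k => (b (J k) : V) := fun n v => by
    rw [← hs]
    simp only [hproj]
    refine ((a n).toMultilinearMap.map_sum fun k i =>
      (inner ℝ (b i : V) (v k) : ℝ) • (b i : V)).trans ?_
    exact Finset.sum_congr rfl fun J _ => (a n).toMultilinearMap.map_smul_univ _ _
  refine ⟨∑ n ∈ Finset.range (Module.finrank ℝ γ.1 + 1),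
    ∑ J : Fin n → Fin (Module.finrank ℝ γ.1), (a n fun k => (b (J k) : V)) •
      ιMulti ℝ n fun k => b (J k), ?_⟩
  simp only [map_sum, map_smul, map_apply_ιMulti]
  funext n
  ext v
  have hev : ∀ (s : Finset ℕ) (f : ℕ → FockSeq V), (∑ m ∈ s, f m) n v = ∑ m ∈ s, f m n v :=
    fun s f => by rw [Finset.sum_apply, ContinuousAlternatingMap.sum_apply]
  have hev' : ∀ m, (∑ J : Fin m → Fin (Module.finrank ℝ γ.1), (a m fun k => (b (J k) : V)) •
      toForms (ιMulti ℝ m (γ.1.subtype ∘ fun k => b (J k)))) n v =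
      if m = n then a n v else 0 := by
    intro m
    rw [Finset.sum_apply, ContinuousAlternatingMap.sum_apply]
    simp only [Pi.smul_apply, ContinuousAlternatingMap.smul_apply, smul_eq_mul]
    split_ifs with hm
    · subst hm
      have h1 : ∀ J : Fin m → Fin (Module.finrank ℝ γ.1),
          (a m fun k => (b (J k) : V)) *
            toForms (ιMulti ℝ m (γ.1.subtype ∘ fun k => b (J k))) m v =
          ∑ π : Equiv.Perm (Fin m), (m.factorial : ℝ)⁻¹ * (((Equiv.Perm.sign π : ℤ) : ℝ) *
            ((∏ k, inner ℝ (b (J k) : V) (v (π k))) * a m fun k => (b (J k) : V))) := by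
        intro J
        rw [toForms_ιMulti rfl, ← Matrix.det_transpose, Matrix.det_apply', Finset.mul_sum,
          Finset.mul_sum]
        refine Finset.sum_congr rfl fun π _ => ?_
        simp only [Matrix.transpose_apply, Matrix.of_apply, Fin.cast_eq_self, Function.comp_apply,
          Submodule.subtype_apply, real_inner_comm]
        ring
      have h2 : ∀ π : Equiv.Perm (Fin m), ∑ J : Fin m → Fin (Module.finrank ℝ γ.1),
          (m.factorial : ℝ)⁻¹ * (((Equiv.Perm.sign π : ℤ) : ℝ) *
            ((∏ k, inner ℝ (b (J k) : V) (v (π k))) * a m fun k => (b (J k) : V))) =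
          (m.factorial : ℝ)⁻¹ * a m v := by
        intro π
        rw [← Finset.mul_sum, ← Finset.mul_sum, ← hexp m fun k => v (π k)]
        have h3 : (a m fun k => v (π k)) = ((Equiv.Perm.sign π : ℤ) : ℝ) * a m v := by
          refine ((a m).toAlternatingMap.map_perm v π).trans ?_
          rw [Units.smul_def, zsmul_eq_mul]
          rfl
        rw [h3, sign_mul_sign_mul]
      simp only [h1]
      rw [Finset.sum_comm, Finset.sum_congr rfl fun π _ => h2 π, Finset.sum_const,
        Finset.card_univ, Fintype.card_perm, Fintype.card_fin, nsmul_eq_mul,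
        mul_inv_cancel_left₀ (by exact_mod_cast m.factorial_ne_zero)]
    · refine Finset.sum_eq_zero fun J _ => ?_
      rw [toForms_ιMulti_of_ne (Ne.symm hm), mul_zero]
  rw [hev]
  simp only [hev', Finset.sum_ite_eq', Finset.mem_range]
  split_ifs with hn
  · rfl
  -- Components of degree larger than the dimension of `γ` vanish.
  · rw [hexp]
    refine (Finset.sum_eq_zero fun J _ => ?_).symm
    rw [(a n).map_eq_zero_of_not_injective, mul_zero]
    intro hJ
    have := Fintype.card_le_of_injective (fun k => J k) fun i j hij => hJ (by simp [hij])
    simp at this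
    omega

theorem exists_toFock_eq (γ : FinKrein V) {ξ : Fock V} (hξ : ξ ∈ truncation γ) :
    ∃ w : ExteriorAlgebra ℝ γ.1, toFock (map γ.1.subtype w) = ξ := by
  obtain ⟨w, hw⟩ := exists_toForms_eq γ ξ.seq hξ
  exact ⟨w, Fock.seq_injective hw⟩

/-- The inner product with a product of vectors is the evaluation on these vectors. -/
theorem inner_toFock_ιMulti (w : ExteriorAlgebra ℝ V) (n : ℕ) (x : Fin n → V) :
    inner ℝ (toFock w) (toFock (ιMulti ℝ n x)) = (vac (interiors x w) : ℝ) := by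
  rw [Fock.inner_eq]
  refine (lp.hasSum_inner (𝕜 := ℝ) _ _).unique ?_
  have hinj : Function.Injective fun z : Fin n → onBasis V => (⟨n, z⟩ : FockIdx V) :=
    fun z z' h => by simpa using h
  rw [← hinj.hasSum_iff]
  -- Each permutation in the determinant contributes the same amount.
  · have h1 : ∀ π : Equiv.Perm (Fin n), HasSum (fun z : Fin n → onBasis V =>
        (n.factorial : ℝ)⁻¹ * (((Equiv.Perm.sign π : ℤ) : ℝ) *
          (vac (interiors (fun i => (z i : V)) w) * ∏ i, inner ℝ (z i : V) (x (π i)))))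
        ((n.factorial : ℝ)⁻¹ * vac (interiors x w)) := fun π => by
      have h2 := hasSum_interiors_mul (isONBasis_onBasis V) w fun i => x (π i)
      have h3 : vac (interiors (fun i => x (π i)) w) =
          ((Equiv.Perm.sign π : ℤ) : ℝ) * vac (interiors x w) := by
        rw [← interiorForm_apply, ← interiorForm_apply]
        refine ((interiorForm n w).map_perm x π).trans ?_
        rw [Units.smul_def, zsmul_eq_mul]
      rw [h3] at h2
      have h4 := (h2.mul_left ((Equiv.Perm.sign π : ℤ) : ℝ)).mul_left (n.factorial : ℝ)⁻¹
      rwa [sign_mul_sign_mul] at h4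
    have h5 := hasSum_sum (s := Finset.univ) fun π _ => h1 π
    rw [Finset.sum_const, Finset.card_univ, Fintype.card_perm, Fintype.card_fin, nsmul_eq_mul,
      mul_inv_cancel_left₀ (by exact_mod_cast n.factorial_ne_zero)] at h5
    refine h5.congr_fun fun z => ?_
    rw [Function.comp_apply, Fock.coord_apply, Fock.coord_apply, fockCoord, fockCoord,
      seq_toFock, seq_toFock, toForms_apply, toForms_ιMulti rfl, Matrix.det_apply']
    simp only [RCLike.inner_apply, conj_trivial, Matrix.of_apply, Fin.cast_eq_self,
      ← Finset.mul_sum, mul_left_comm _ (vac _)]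
    have h6 : √(n.factorial : ℝ) * √(n.factorial : ℝ) = n.factorial :=
      Real.mul_self_sqrt (by positivity)
    have h7 : (n.factorial : ℝ) ≠ 0 := by exact_mod_cast n.factorial_ne_zero
    calc _ = (√(n.factorial : ℝ) * √(n.factorial : ℝ)) * (n.factorial : ℝ)⁻¹ *
          (vac (interiors (fun i => (z i : V)) w) * ((n.factorial : ℝ)⁻¹ *
            ∑ π : Equiv.Perm (Fin n), ((Equiv.Perm.sign π : ℤ) : ℝ) *
              ∏ i, inner ℝ (z i : V) (x (π i)))) := by ring
      _ = _ := by rw [h6, mul_inv_cancel₀ h7, one_mul]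
  · rintro ⟨m, z⟩ hz
    have hm : m ≠ n := by
      rintro rfl
      exact hz ⟨z, rfl⟩
    rw [Fock.coord_apply, Fock.coord_apply, fockCoord, fockCoord, seq_toFock, seq_toFock,
      toForms_ιMulti_of_ne hm]
    simp

theorem expand_truncation (γ : FinKrein V) {ξ : Fock V} (hξ : ξ ∈ truncation γ) :
    ξ = ((frame γ).sublists'.map fun l =>
      (inner ℝ (toFock (l.map (ι ℝ)).prod) ξ : ℝ) • toFock (l.map (ι ℝ)).prod).sum := by
  obtain ⟨w, rfl⟩ := exists_toFock_eq γ hξ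
  conv_lhs => rw [← expand_frame, expand, map_list_sum, List.map_map]
  congr 2
  funext l
  rw [Function.comp_apply, map_smul, real_inner_comm, list_prod_ι, inner_toFock_ιMulti]

end Frame

end FermiAlgebra

/-! ### Traces over truncations -/

namespace FermiAlgebra

open ExteriorAlgebra KreinSpace

section Truncation

variable {V : Type*} [NormedAddCommGroup V] [InnerProductSpace ℝ V] [KreinSpace V]

theorem finiteDimensional_truncation (γ : FinKrein V) : FiniteDimensional ℝ (truncation γ) := by
  let s : Set (Fock V) :=
    {x | x ∈ (frame γ).sublists'.map fun l => toFock (l.map (ι ℝ)).prod}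
  have hs : FiniteDimensional ℝ (Submodule.span ℝ s) :=
    FiniteDimensional.span_of_finite ℝ (List.finite_toSet _)
  refine Submodule.finiteDimensional_of_le (S₂ := Submodule.span ℝ s) fun ξ hξ => ?_
  rw [expand_truncation γ hξ]
  refine list_sum_mem fun x hx => ?_
  obtain ⟨l, hl, rfl⟩ := List.mem_map.1 hx
  exact Submodule.smul_mem _ _ (Submodule.subset_span (List.mem_map.2 ⟨l, hl, rfl⟩))

theorem exists_finKrein_of_finite {s : Set V} (hs : s.Finite) :
    ∃ γ : FinKrein V, s ⊆ γ.1 := by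
  refine ⟨⟨Submodule.span ℝ (s ∪ sym '' s),
    FiniteDimensional.span_of_finite ℝ (hs.union (hs.image _)), fun x hx => ?_⟩,
    fun x hx => Submodule.subset_span (Or.inl hx)⟩
  induction hx using Submodule.span_induction with
  | mem x h =>
    rcases h with h | ⟨y, hy, rfl⟩
    · exact Submodule.subset_span (Or.inr ⟨x, h, rfl⟩)
    · rw [sym_sym]; exact Submodule.subset_span (Or.inl hy)
  | zero => rw [map_zero]; exact Submodule.zero_mem _
  | add x y _ _ hx hy => rw [map_add]; exact Submodule.add_mem _ hx hy
  | smul c x _ hx => rw [map_smul]; exact Submodule.smul_mem _ c hx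

/-- The Krein subspace spanned by finitely many vectors of the chosen ON-basis. -/
noncomputable def basisSpan {n : ℕ} (z : Fin n → onBasis V) : FinKrein V :=
  ⟨Submodule.span ℝ (Set.range fun k => (z k : V)),
    FiniteDimensional.span_of_finite ℝ (Set.finite_range _), fun x hx => by
      induction hx using Submodule.span_induction with
      | mem x h =>
        obtain ⟨k, rfl⟩ := h
        change sym (z k : V) ∈ _
        rw [(isONBasis_onBasis V).sym_eq]
        exact Submodule.smul_mem _ _ (Submodule.subset_span ⟨k, rfl⟩)
      | zero => rw [map_zero]; exact Submodule.zero_mem _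
      | add x y _ _ hx hy => rw [map_add]; exact Submodule.add_mem _ hx hy
      | smul c x _ hx => rw [map_smul]; exact Submodule.smul_mem _ c hx⟩

open Classical in
theorem basisSpan_proj {n : ℕ} (z : Fin n → onBasis V) (i : onBasis V) :
    (basisSpan z).proj (i : V) = if i ∈ Set.range z then (i : V) else 0 := by
  split_ifs with h
  · obtain ⟨k, rfl⟩ := h
    exact proj_of_mem _ (Submodule.subset_span ⟨k, rfl⟩)
  · have := (basisSpan z).2.1
    refine (Submodule.starProjection_apply_eq_zero_iff (basisSpan z).1).2 ?_
    refine (Submodule.mem_orthogonal' _ _).2 fun x hx => ?_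
    induction hx using Submodule.span_induction with
    | mem x hx =>
      obtain ⟨k, rfl⟩ := hx
      exact (isONBasis_onBasis V).orthonormal.2 fun e => h ⟨k, e.symm⟩
    | zero => exact inner_zero_right _
    | add x y _ _ hx hy => rw [inner_add_right, hx, hy, add_zero]
    | smul c x _ hx => rw [inner_smul_right, hx, mul_zero]

/-- The truncated elements are dense: an element orthogonal to all of them is orthogonal to its own
truncations, whose coefficients are some of its own. -/
theorem dense_truncated : Dense (truncated V : Set (Fock V)) := by
  rw [Submodule.dense_iff_topologicalClosure_eq_top, Submodule.topologicalClosure_eq_top_iff,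
    Submodule.eq_bot_iff]
  intro σ hσ
  refine Fock.coord_injective ((lp.ext (funext fun p => ?_)).trans (map_zero _).symm)
  obtain ⟨n, z⟩ := p
  have hQ : FockSeq.pullback (basisSpan z).proj (FockSeq.pullback (basisSpan z).proj σ.seq) =
      FockSeq.pullback (basisSpan z).proj σ.seq := by
    refine funext fun n => ContinuousAlternatingMap.ext fun x => ?_
    change σ.seq n (fun k => (basisSpan z).proj ((basisSpan z).proj (x k))) =
      σ.seq n fun k => (basisSpan z).proj (x k)
    simp only [proj_of_mem _ (proj_mem (basisSpan z) _)]
  obtain ⟨w, hw⟩ := exists_toForms_eq (basisSpan z) _ hQ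
  have h0 := (Submodule.mem_orthogonal _ _).1 hσ _ ⟨basisSpan z, toFock_mem_truncation _ w⟩
  rw [Fock.inner_eq] at h0
  have h1 := lp.hasSum_inner (𝕜 := ℝ) (Fock.coord (toFock (map (basisSpan z).1.subtype w)))
    (Fock.coord σ)
  rw [h0] at h1
  have hc : ∀ p : FockIdx V, Fock.coord (toFock (map (basisSpan z).1.subtype w)) p =
      √(p.1.factorial : ℝ) * σ.seq p.1 fun k => (basisSpan z).proj (p.2 k : V) := fun p => by
    rw [Fock.coord_apply, seq_toFock, hw]
    rfl
  have h2 : ∀ p : FockIdx V, 0 ≤ (inner ℝ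
      (Fock.coord (toFock (map (basisSpan z).1.subtype w)) p) (Fock.coord σ p) : ℝ) := by
    intro p
    rw [hc, Fock.coord_apply, fockCoord, RCLike.inner_apply, conj_trivial]
    by_cases hp : ∀ k, p.2 k ∈ Set.range z
    · simp only [basisSpan_proj, hp, if_true]
      exact mul_self_nonneg _
    · obtain ⟨k, hk⟩ := not_forall.1 hp
      have hz : (σ.seq p.1 fun k => (basisSpan z).proj (p.2 k : V)) = 0 :=
        (σ.seq p.1).map_coord_zero k (by
          change (basisSpan z).proj (p.2 k : V) = 0
          rw [basisSpan_proj, if_neg hk])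
      rw [hz, mul_zero, mul_zero]
  have h3 := congrFun ((hasSum_zero_iff_of_nonneg h2).1 h1) ⟨n, z⟩
  have h4 : Fock.coord (toFock (map (basisSpan z).1.subtype w)) ⟨n, z⟩ = Fock.coord σ ⟨n, z⟩ := by
    rw [hc, Fock.coord_apply, fockCoord]
    simp only [basisSpan_proj, Set.mem_range_self, if_true]
  rw [h4, RCLike.inner_apply, conj_trivial] at h3
  exact mul_self_eq_zero.1 h3

end Truncation

/-- The trace of a bilinear form over a subspace `K`, computed in an ON-basis of the whole space, is
determined by any finite Parseval frame of `K`. -/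
theorem hasSum_trace {H ι : Type*} [NormedAddCommGroup H] [InnerProductSpace ℝ H] [KreinSpace H]
    {ξ : ι → H} (hξ : IsONBasis ξ) (K : Submodule ℝ H) [K.HasOrthogonalProjection]
    {κ : Type*} [Fintype κ] [DecidableEq κ] (e : κ → H) (he : ∀ j, e j ∈ K)
    (hexp : ∀ x ∈ K, x = ∑ j, (inner ℝ (e j) x : ℝ) • e j) (β : H → H → ℝ)
    (hβ : ∀ c c' : κ → ℝ, β (∑ j, c j • e j) (∑ j, c' j • e j) =
      ∑ i, ∑ j, c i * c' j * β (e i) (e j)) :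
    HasSum (fun i => β (K.starProjection (ξ i)) (K.starProjection (ξ i)))
      (∑ j, β (e j) (e j)) := by
  have h1 : ∀ x, K.starProjection x = ∑ j, (inner ℝ (e j) x : ℝ) • e j := fun x => by
    conv_lhs => rw [hexp _ (K.starProjection_apply_mem x)]
    refine Finset.sum_congr rfl fun j _ => ?_
    rw [← K.inner_starProjection_left_eq_right, Submodule.starProjection_eq_self_iff.2 (he j)]
  have h2 : ∀ j, β (e j) (e j) = ∑ l, inner ℝ (e j) (e l) * β (e j) (e l) := fun j => by
    have h := hβ (Pi.single j 1) fun l => inner ℝ (e l) (e j)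
    rw [← hexp _ (he j)] at h
    have h' : ∑ i, (Pi.single j 1 : κ → ℝ) i • e i = e j := by
      simp [Pi.single_apply, ite_smul]
    rw [h'] at h
    rw [h]
    simp [Pi.single_apply, ite_mul, real_inner_comm]
  simp only [h2, h1, hβ]
  refine hasSum_sum fun j _ => hasSum_sum fun l _ => ?_
  refine ((hasSum_inner_mul_inner hξ (e j) (e l)).mul_right (β (e j) (e l))).congr_fun fun i => ?_
  rw [real_inner_comm, real_inner_comm (ξ i) (e l)]

/-! ### The copairing element -/

section Copairing

variable {V L : Type*} [NormedAddCommGroup V] [InnerProductSpace ℝ V] [NormedAddCommGroup L]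
  [InnerProductSpace ℝ L]

/-- The element `∏ₓ (1 + p x ∧ q x)`, the product over the vectors of a list. It is written so that
`q` acquires the reversed order of factors; the vectors `q x` commute with it, as it is even. -/
noncomputable def copairing (p q : L →ₗ[ℝ] V) : List L → ExteriorAlgebra ℝ V
  | [] => 1
  | x :: l => copairing p q l + ι ℝ (p x) * copairing p q l * ι ℝ (q x)

/-- The copairing element is the sum over all monomials of the product of their images, the second
one reversed. -/
theorem copairing_eq_sum (p q : L →ₗ[ℝ] V) (l : List L) :
    (l.sublists'.map fun k => map p (k.map (ι ℝ)).prod *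
      map q (CliffordAlgebra.reverse (k.map (ι ℝ)).prod)).sum = copairing p q l := by
  induction l with
  | nil => simp [copairing]
  | cons x l ih =>
    rw [List.sublists'_cons, List.map_append, List.sum_append, ih, copairing, ← ih,
      ← List.sum_map_mul_left, ← List.sum_map_mul_right, List.map_map]
    congr 3
    funext k
    simp only [Function.comp_apply, List.map_cons, List.prod_cons, map_mul, map_apply_ι,
      CliffordAlgebra.reverse.map_mul]
    have : CliffordAlgebra.reverse (ι ℝ x) = ι ℝ x := CliffordAlgebra.reverse_ι x
    rw [this, map_apply_ι]
    simp only [mul_assoc]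

theorem copairing_mul_ι (p q : L →ₗ[ℝ] V) (l : List L) (y : V) :
    copairing p q l * ι ℝ y = ι ℝ y * copairing p q l := by
  induction l with
  | nil => simp [copairing]
  | cons x l ih =>
    rw [copairing, add_mul, mul_add, ih, mul_assoc _ (ι ℝ (q x)), ι_mul_ι_comm (q x), mul_neg,
      ← mul_assoc _ (ι ℝ y), mul_assoc _ _ (ι ℝ y), ih, ← mul_assoc (ι ℝ (p x)), ι_mul_ι_comm (p x)]
    simp only [mul_assoc, neg_mul, neg_neg]

/-- The vector that describes the logarithmic derivative of the copairing element, see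
`interior_copairing`. -/
noncomputable def copairingVec (p q : L →ₗ[ℝ] V) (l : List L) (v : V) : V :=
  (l.map fun x => (inner ℝ v (p x) : ℝ) • q x - (inner ℝ v (q x) : ℝ) • p x).sum

theorem interior_copairing (p q : L →ₗ[ℝ] V) (l : List L) (v : V) :
    interior v (copairing p q l) = ι ℝ (copairingVec p q l v) * copairing p q l := by
  induction l with
  | nil => simp [copairing, copairingVec, interior_one]
  | cons x l ih =>
    have hv : copairingVec p q (x :: l) v = (inner ℝ v (p x) : ℝ) • q x -
        (inner ℝ v (q x) : ℝ) • p x + copairingVec p q l v := by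
      rw [copairingVec, List.map_cons, List.sum_cons, copairingVec]
    rw [copairing, hv, mul_assoc, copairing_mul_ι, map_add, interior_ι_mul, interior_ι_mul, ih]
    generalize copairingVec p q l v = η
    generalize copairing p q l = θ
    have e1 : ι ℝ η * (ι ℝ (p x) * (ι ℝ (q x) * θ)) = ι ℝ (p x) * (ι ℝ (q x) * (ι ℝ η * θ)) := by
      simp only [← mul_assoc]
      rw [ι_mul_ι_comm η (p x), neg_mul (ι ℝ (p x) * _), mul_assoc (ι ℝ (p x)),
        ι_mul_ι_comm η (q x), mul_neg]
      simp only [neg_neg, mul_assoc]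
    have e2 : ι ℝ (q x) * (ι ℝ (p x) * (ι ℝ (q x) * θ)) = 0 := by
      rw [← mul_assoc, ι_mul_ι_comm (q x), neg_mul, mul_assoc, ← mul_assoc (ι ℝ (q x)), ι_sq_zero]
      simp
    have e3 : ι ℝ (p x) * (ι ℝ (p x) * (ι ℝ (q x) * θ)) = 0 := by
      rw [← mul_assoc, ι_sq_zero, zero_mul]
    simp only [map_add, map_sub, map_smul, add_mul, sub_mul, mul_add, mul_sub, smul_mul_assoc,
      mul_smul_comm, e1, e2, e3, smul_zero]
    abel

end Copairing

end FermiAlgebra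

/-! ### Gluing in a truncation -/

namespace FermiAlgebra

open ExteriorAlgebra KreinSpace

/-- A decomposition `V = L₁ ⊕ L ⊕ L̄` of a Krein space into Krein spaces, where `L̄` is `L` with the
opposite indefinite inner product: the inclusions `j₀, j₁, j₂` and their adjoints, the projections
`p₀, p₁, p₂`. The summand `L̄` is identified with `L` by an isometry, whence the sign in `sym₂`. -/
structure GluingSplit (V L₁ L : Type*) [NormedAddCommGroup V] [InnerProductSpace ℝ V]
    [KreinSpace V] [NormedAddCommGroup L₁] [InnerProductSpace ℝ L₁] [KreinSpace L₁]
    [NormedAddCommGroup L] [InnerProductSpace ℝ L] [KreinSpace L] where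
  p₀ : V →L[ℝ] L₁
  p₁ : V →L[ℝ] L
  p₂ : V →L[ℝ] L
  j₀ : L₁ →ₗ[ℝ] V
  j₁ : L →ₗ[ℝ] V
  j₂ : L →ₗ[ℝ] V
  adj₀ : ∀ x v, inner ℝ v (j₀ x) = (inner ℝ (p₀ v) x : ℝ)
  adj₁ : ∀ x v, inner ℝ v (j₁ x) = (inner ℝ (p₁ v) x : ℝ)
  adj₂ : ∀ x v, inner ℝ v (j₂ x) = (inner ℝ (p₂ v) x : ℝ)
  p₀_add : ∀ x y z, p₀ (j₀ x + j₁ y + j₂ z) = x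
  p₁_add : ∀ x y z, p₁ (j₀ x + j₁ y + j₂ z) = y
  p₂_add : ∀ x y z, p₂ (j₀ x + j₁ y + j₂ z) = z
  sym₀ : ∀ x, sym (j₀ x) = j₀ (sym x)
  sym₁ : ∀ x, sym (j₁ x) = j₁ (sym x)
  sym₂ : ∀ x, sym (j₂ x) = -j₂ (sym x)

namespace GluingSplit

variable {V L₁ L : Type*} [NormedAddCommGroup V] [InnerProductSpace ℝ V] [KreinSpace V]
  [NormedAddCommGroup L₁] [InnerProductSpace ℝ L₁] [KreinSpace L₁]
  [NormedAddCommGroup L] [InnerProductSpace ℝ L] [KreinSpace L] (G : GluingSplit V L₁ L)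

/-- The antisymmetrized product of the pullbacks of three elements; the third one is taken with its
arguments in reverse order. -/
noncomputable def tau (σ : Fock L₁) (ξ ξ' : Fock L) : FockSeq V :=
  ((FockSeq.pullback G.p₀ σ.seq).wedge (FockSeq.pullback G.p₁ ξ.seq)).wedge
    (FockSeq.pullback G.p₂ ξ'.seq.reverse)

theorem tau_toFock (s : ExteriorAlgebra ℝ L₁) (a b : ExteriorAlgebra ℝ L) :
    G.tau (toFock s) (toFock a) (toFock b) =
      toForms (map G.j₀ s * map G.j₁ a * map G.j₂ (CliffordAlgebra.reverse b)) := by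
  rw [tau, seq_toFock, seq_toFock, seq_toFock, reverse_toForms, pullback_toForms G.j₀ G.p₀ G.adj₀,
    pullback_toForms G.j₁ G.p₁ G.adj₁, pullback_toForms G.j₂ G.p₂ G.adj₂, toForms_mul, toForms_mul]

theorem sym_toFock (w : ExteriorAlgebra ℝ L) :
    sym (toFock w) = toFock (map (sym (V := L)).toLinearMap w) := by
  apply Fock.seq_injective
  change FockSeq.pullback (sym (V := L)).toContinuousLinearMap (toForms w) = toForms _
  exact pullback_toForms _ _ (fun x v => (inner_sym_left v x).symm) w

/-- Gluing by summing over an ON-basis inserts the copairing element of the truncation into the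
Gaussian functional. -/
theorem hasSum_glue (u : V →ₗ[ℝ] V) (hu : ∀ x y, inner ℝ (u x) y = (inner ℝ x (u y) : ℝ))
    (hh : ∀ x, inner ℝ ((u.comp sym.toLinearMap) x) x = (0 : ℝ)) (s : ExteriorAlgebra ℝ L₁)
    (γ : FinKrein L) {ι' : Type*} {ξ : ι' → Fock L} (hξ : IsONBasis ξ) :
    HasSum (fun i => (-1 : ℝ) ^ sig (ξ i) *
      probMap u (G.tau (toFock s) (truncProj γ (ξ i)) (truncProj γ (ξ i))))
      (gauss (u.comp sym.toLinearMap) hh (map G.j₀ s *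
        copairing (G.j₁.comp sym.toLinearMap) G.j₂ (frame γ))) := by
  let e : Fin (frame γ).sublists'.length → ExteriorAlgebra ℝ L :=
    fun j => ((frame γ).sublists'[j].map (ι ℝ)).prod
  have hval : ∀ a b, probMap u (G.tau (toFock s) (sym (toFock a)) (toFock b)) =
      gauss (u.comp sym.toLinearMap) hh (map G.j₀ s * map G.j₁ (map sym.toLinearMap a) *
        map G.j₂ (CliffordAlgebra.reverse b)) := fun a b => by
    rw [sym_toFock, tau_toFock, probMap_toForms u hu hh]
  have hmem : ∀ j, toFock (e j) ∈ truncation γ := by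
    intro j
    have h1 : ∀ l : List L, (∀ x ∈ l, x ∈ γ.1) →
        ∃ w : ExteriorAlgebra ℝ γ.1, map γ.1.subtype w = (l.map (ι ℝ)).prod := by
      intro l hl
      induction l with
      | nil => exact ⟨1, by simp⟩
      | cons x l ih =>
        obtain ⟨w, hw⟩ := ih fun y hy => hl y (List.mem_cons_of_mem _ hy)
        refine ⟨ι ℝ ⟨x, hl x List.mem_cons_self⟩ * w, ?_⟩
        rw [map_mul, map_apply_ι, hw, List.map_cons, List.prod_cons]
        rfl
    obtain ⟨w, hw⟩ := h1 (frame γ).sublists'[j] fun x hx => mem_of_mem_frame γ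
      ((List.mem_sublists'.1 (List.getElem_mem _)).subset hx)
    change toFock ((frame γ).sublists'[j].map (ι ℝ)).prod ∈ _
    rw [← hw]
    exact toFock_mem_truncation γ w
  have h1 := hasSum_trace hξ (truncation γ) (fun j => toFock (e j)) hmem
    (fun x hx => by
      conv_lhs => rw [expand_truncation γ hx, ← Fin.sum_univ_fun_getElem]
      rfl)
    (fun x y => probMap u (G.tau (toFock s) (sym x) y)) (fun c c' => by
      simp only [← map_smul, ← map_sum, hval]
      simp only [map_smul, map_sum, Finset.mul_sum, Finset.sum_mul, smul_mul_assoc, mul_smul_comm,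
        smul_eq_mul]
      rw [Finset.sum_comm]
      refine Finset.sum_congr rfl fun i _ => Finset.sum_congr rfl fun j _ => ?_
      ring)
  have h2 : ∑ j, probMap u (G.tau (toFock s) (sym (toFock (e j))) (toFock (e j))) =
      gauss (u.comp sym.toLinearMap) hh (map G.j₀ s *
        copairing (G.j₁.comp sym.toLinearMap) G.j₂ (frame γ)) := by
    simp only [hval]
    rw [← copairing_eq_sum, ← Fin.sum_univ_fun_getElem, Finset.mul_sum, map_sum]
    refine Finset.sum_congr rfl fun j _ => ?_
    rw [mul_assoc, ← AlgHom.comp_apply, map_comp_map]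
    rfl
  rw [h2] at h1
  refine h1.congr_fun fun i => ?_
  -- The sign `(-1)^[ξᵢ]` is the action of `sym`, which commutes with the projector.
  rw [← starProjection_sym _ (fun x hx => sym_mem_truncation γ hx), hξ.sym_eq, map_smul]
  obtain ⟨w, hw⟩ := exists_toFock_eq γ ((truncation γ).starProjection_apply_mem (ξ i))
  change (-1 : ℝ) ^ sig (ξ i) * probMap u (G.tau (toFock s) ((truncation γ).starProjection (ξ i))
    ((truncation γ).starProjection (ξ i))) = _
  rw [← hw, ← map_smul, tau_toFock, tau_toFock, probMap_toForms u hu hh, probMap_toForms u hu hh]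
  simp only [map_smul, mul_smul_comm, smul_mul_assoc, smul_eq_mul]

variable {N : Submodule ℝ V} (hN : IsHypermaximalNeutral N) {N₁ : Submodule ℝ L₁}
  (hN₁ : IsHypermaximalNeutral N₁)

/-- A vector `y` of `L₁` extends to a vector `X` of `V` for which the interior product with `-h X`,
where `h` is the reversal composed with `sym`, acts on `L₁` as that with `-h₁ y` and on the
copairing element as multiplication by `X - j₀ y`, as soon as the truncation contains two
vectors `l`, `m`. -/
theorem exists_extension (hglue : ∀ n ∈ N₁, ∃ l, G.j₀ n + G.j₁ l + G.j₂ l ∈ N) (y : L₁) :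
    ∃ l m : L, ∀ γ : FinKrein L, l ∈ γ.1 → m ∈ γ.1 → ∃ X : V,
      X = G.j₀ y + copairingVec (G.j₁.comp sym.toLinearMap) G.j₂ (frame γ)
        (-reversal N hN (sym X)) ∧
      G.p₀ (-reversal N hN (sym X)) = -reversal N₁ hN₁ (sym y) := by
  -- On vectors with components in `γ` the truncation is not visible in `copairingVec`.
  have hvec : ∀ (γ : FinKrein L) (v : V), G.p₁ v ∈ γ.1 → G.p₂ v ∈ γ.1 →
      copairingVec (G.j₁.comp sym.toLinearMap) G.j₂ (frame γ) v =
        G.j₂ (sym (G.p₁ v)) - G.j₁ (sym (G.p₂ v)) := by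
    intro γ v h1 h2
    have e1 := congrArg G.j₂ (sum_frame γ (γ.2.2 _ h1))
    have e2 := congrArg (G.j₁.comp sym.toLinearMap) (sum_frame γ h2)
    rw [map_list_sum, List.map_map] at e1 e2
    have e2' : G.j₁ (sym (G.p₂ v)) = (G.j₁.comp sym.toLinearMap) (G.p₂ v) := rfl
    rw [e2', ← e1, ← e2, copairingVec, ← sub_eq_zero]
    generalize frame γ = l
    induction l with
    | nil => simp
    | cons x l ih =>
      simp only [List.map_cons, List.sum_cons, Function.comp_apply, map_smul] at ih ⊢
      have e3 : (inner ℝ v ((G.j₁.comp sym.toLinearMap) x) : ℝ) = inner ℝ x (sym (G.p₁ v)) := by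
        rw [← inner_sym_left]
        exact (G.adj₁ (sym x) v).trans (real_inner_comm _ _)
      have e4 : (inner ℝ v (G.j₂ x) : ℝ) = inner ℝ x (G.p₂ v) := by
        rw [G.adj₂, real_inner_comm]
      rw [e3, e4]
      rw [sub_eq_zero] at ih ⊢
      rw [ih]
      abel
  -- Split `sym y = a + b` with `a` and `sym b` in `N₁`; the reversal is `1` on `a` and `-1` on `b`.
  have ha : (2⁻¹ : ℝ) • (sym y + reversal N₁ hN₁ (sym y)) ∈ N₁ :=
    mem_of_reversal_eq hN₁ (by rw [map_smul, map_add, reversal_reversal, add_comm])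
  have hb : sym ((2⁻¹ : ℝ) • (sym y - reversal N₁ hN₁ (sym y))) ∈ N₁ :=
    mem_of_reversal_eq hN₁ (by
      rw [← neg_neg (reversal N₁ hN₁ (sym _)), ← sym_reversal, map_smul, map_sub,
        reversal_reversal, ← map_neg, ← smul_neg, neg_sub])
  have hab : (2⁻¹ : ℝ) • (sym y + reversal N₁ hN₁ (sym y)) +
      (2⁻¹ : ℝ) • (sym y - reversal N₁ hN₁ (sym y)) = sym y := by module
  have hab' : (2⁻¹ : ℝ) • (sym y - reversal N₁ hN₁ (sym y)) -
      (2⁻¹ : ℝ) • (sym y + reversal N₁ hN₁ (sym y)) = -reversal N₁ hN₁ (sym y) := by module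
  generalize (2⁻¹ : ℝ) • (sym y + reversal N₁ hN₁ (sym y)) = a at ha hab hab'
  generalize (2⁻¹ : ℝ) • (sym y - reversal N₁ hN₁ (sym y)) = b at hb hab hab'
  obtain ⟨l, hl⟩ := hglue _ ha
  obtain ⟨m, hm⟩ := hglue _ hb
  refine ⟨l, m, fun γ hlγ hmγ => ?_⟩
  have e1 := reversal_of_mem hN hl
  have e2 : reversal N hN (sym (G.j₀ (sym b) + G.j₁ m + G.j₂ m)) =
      -sym (G.j₀ (sym b) + G.j₁ m + G.j₂ m) := by
    rw [← neg_neg (reversal N hN _), ← sym_reversal, reversal_of_mem hN hm]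
  have e3 : sym (G.j₀ (sym b) + G.j₁ m + G.j₂ m) = G.j₀ b + G.j₁ (sym m) - G.j₂ (sym m) := by
    rw [map_add, map_add, G.sym₀, G.sym₁, G.sym₂, sym_sym, sub_eq_add_neg]
  rw [e3] at e2
  -- `sym X` is the sum of the extension of `a` and of `sym` of the extension of `sym b`.
  refine ⟨sym (G.j₀ (a + b) + G.j₁ (l + sym m) + G.j₂ (l - sym m)), ?_⟩
  have e4 : -reversal N hN (sym (sym (G.j₀ (a + b) + G.j₁ (l + sym m) + G.j₂ (l - sym m)))) =
      G.j₀ (b - a) + G.j₁ (sym m - l) + G.j₂ (-(l + sym m)) := by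
    have : G.j₀ (a + b) + G.j₁ (l + sym m) + G.j₂ (l - sym m) =
        (G.j₀ a + G.j₁ l + G.j₂ l) + (G.j₀ b + G.j₁ (sym m) - G.j₂ (sym m)) := by
      simp only [map_add, map_sub]; abel
    rw [sym_sym, this, map_add, e1, e2]
    simp only [map_add, map_sub, map_neg]
    abel
  rw [e4, hvec, G.p₀_add, G.p₁_add, G.p₂_add]
  · refine ⟨?_, hab'⟩
    rw [map_add, map_add, G.sym₀, G.sym₁, G.sym₂, hab, sym_sym]
    simp only [map_sub, map_neg, map_add, sym_sym]
    abel
  · rw [G.p₁_add]; exact γ.1.sub_mem (γ.2.2 _ hmγ) hlγ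
  · rw [G.p₂_add]; exact γ.1.neg_mem (γ.1.add_mem hlγ (γ.2.2 _ hmγ))

/-- Integration by parts in the presence of the copairing element. -/
theorem gauss_ι_mul_copairing (h : V →ₗ[ℝ] V) (hh : ∀ x, inner ℝ (h x) x = (0 : ℝ))
    (p q : L →ₗ[ℝ] V) (l : List L) {X : V} {y y' : L₁}
    (hX : X = G.j₀ y + copairingVec p q l (-h X)) (hy' : G.p₀ (-h X) = y')
    (s : ExteriorAlgebra ℝ L₁) :
    gauss h hh (map G.j₀ (ι ℝ y * s) * copairing p q l) =
      gauss h hh (map G.j₀ (interior y' s) * copairing p q l) := by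
  have h1 := gauss_ι_mul h hh X (map G.j₀ s * copairing p q l)
  have h2 : -gauss h hh (interior (h X) (map G.j₀ s * copairing p q l)) =
      gauss h hh (interior (-h X) (map G.j₀ s * copairing p q l)) := by
    rw [map_neg, LinearMap.neg_apply, map_neg]
  have h3 : ι ℝ X = map G.j₀ (ι ℝ y) + ι ℝ (copairingVec p q l (-h X)) := by
    conv_lhs => rw [hX, map_add, ← map_apply_ι]
  rw [h2, interior_mul, interior_map G.j₀ G.p₀ G.adj₀, hy', interior_copairing,
    ← mul_assoc (parity _), mul_ι, h3, add_mul, map_add, map_add, mul_assoc (ι ℝ _),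
    add_left_inj, ← mul_assoc, ← map_mul] at h1
  exact h1

end GluingSplit

/-- A functional on the exterior algebra that satisfies the recursion of the Gaussian functional for
vectors from a subspace is proportional to it on the exterior algebra of that subspace. -/
theorem eq_gauss_mul {L₁ : Type*} [NormedAddCommGroup L₁] [InnerProductSpace ℝ L₁]
    (h : L₁ →ₗ[ℝ] L₁) (hh : ∀ x, inner ℝ (h x) x = (0 : ℝ)) (F : ExteriorAlgebra ℝ L₁ →ₗ[ℝ] ℝ)
    (K : Submodule ℝ L₁) (hF : ∀ y ∈ K, ∀ s, F (ι ℝ y * s) = F (interior (-h y) s))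
    (w : ExteriorAlgebra ℝ K) : F (map K.subtype w) = gauss h hh (map K.subtype w) * F 1 := by
  have hG : ∀ y s, gauss h hh (ι ℝ y * s) = gauss h hh (interior (-h y) s) := fun y s => by
    rw [gauss_ι_mul, map_neg, LinearMap.neg_apply, map_neg]
  have key : ∀ (n : ℕ) (x : Fin n → L₁), (∀ i, x i ∈ K) →
      F (ιMulti ℝ n x) = gauss h hh (ιMulti ℝ n x) * F 1 := by
    intro n
    induction n using Nat.strong_induction_on with
    | _ n ih =>
      intro x hx
      rcases n with _ | _ | n
      · rw [ιMulti_zero_apply, gauss_one, one_mul]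
      · rw [ιMulti_succ_apply, hF _ (hx 0), hG, ιMulti_zero_apply, interior_one, map_zero, map_zero,
          zero_mul]
      · rw [ιMulti_succ_apply, hF _ (hx 0), hG, interior_ιMulti, map_sum, map_sum, Finset.sum_mul]
        refine Finset.sum_congr rfl fun i _ => ?_
        rw [map_smul, map_smul, ih n (by omega) (fun j => Matrix.vecTail x (i.succAbove j))
          fun j => hx (i.succAbove j).succ, smul_eq_mul, smul_eq_mul]
        ring
  induction w using ιMulti_induction with
  | ιMulti n x => rw [map_apply_ιMulti]; exact key n _ fun i => (x i).2
  | smul c w ih => rw [map_smul, map_smul, map_smul, ih, smul_eq_mul, smul_eq_mul, mul_assoc]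
  | add w w' ih ih' => rw [map_add, map_add, map_add, ih, ih', add_mul]

namespace GluingSplit

variable {V L₁ L : Type*} [NormedAddCommGroup V] [InnerProductSpace ℝ V] [KreinSpace V]
  [NormedAddCommGroup L₁] [InnerProductSpace ℝ L₁] [KreinSpace L₁]
  [NormedAddCommGroup L] [InnerProductSpace ℝ L] [KreinSpace L] (G : GluingSplit V L₁ L)
  {N : Submodule ℝ V} (hN : IsHypermaximalNeutral N) {N₁ : Submodule ℝ L₁}
  (hN₁ : IsHypermaximalNeutral N₁)

/-- On a sufficiently large truncation the glued Gaussian functional factorizes. -/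
theorem exists_gauss_copairing_eq (hglue : ∀ n ∈ N₁, ∃ l, G.j₀ n + G.j₁ l + G.j₂ l ∈ N)
    (α₁ : FinKrein L₁) : ∃ α : FinKrein L, ∀ γ ≥ α, ∀ w : ExteriorAlgebra ℝ α₁.1,
      gauss _ (inner_reversal_sym_self hN) (map G.j₀ (map α₁.1.subtype w) *
        copairing (G.j₁.comp sym.toLinearMap) G.j₂ (frame γ)) =
      gauss _ (inner_reversal_sym_self hN₁) (map α₁.1.subtype w) *
        gauss _ (inner_reversal_sym_self hN)
          (copairing (G.j₁.comp sym.toLinearMap) G.j₂ (frame γ)) := by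
  choose l m hlm using G.exists_extension hN hN₁ hglue
  obtain ⟨α, hα⟩ := exists_finKrein_of_finite (V := L)
    (s := (l '' {y | y ∈ frame α₁}) ∪ (m '' {y | y ∈ frame α₁}))
    (((List.finite_toSet _).image _).union ((List.finite_toSet _).image _))
  refine ⟨α, fun γ hγ w => ?_⟩
  let F : ExteriorAlgebra ℝ L₁ →ₗ[ℝ] ℝ := (gauss _ (inner_reversal_sym_self hN)).comp
    ((LinearMap.mulRight ℝ (copairing (G.j₁.comp sym.toLinearMap) G.j₂ (frame γ))).comp
      (map G.j₀).toLinearMap)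
  have hF : ∀ s, F s = gauss _ (inner_reversal_sym_self hN) (map G.j₀ s *
        copairing (G.j₁.comp sym.toLinearMap) G.j₂ (frame γ)) := fun s => rfl
  have key := eq_gauss_mul _ (inner_reversal_sym_self hN₁) F α₁.1 (fun y hy s => ?_) w
  · rwa [hF, hF, map_one, one_mul] at key
  · have h1 : ∀ y ∈ frame α₁, F (ι ℝ y * s) =
        F (interior (-((reversal N₁ hN₁).comp sym.toLinearMap) y) s) := by
      intro y hy
      obtain ⟨X, hX, hX'⟩ := hlm y γ (hγ (hα (Or.inl ⟨y, hy, rfl⟩)))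
        (hγ (hα (Or.inr ⟨y, hy, rfl⟩)))
      exact G.gauss_ι_mul_copairing _ (inner_reversal_sym_self hN) _ _ _ hX hX' s
    rw [← sum_frame α₁ hy]
    generalize frame α₁ = l at h1
    induction l with
    | nil => simp
    | cons x l ih =>
      rw [List.map_cons, List.sum_cons, map_add, map_add, add_mul, map_add, neg_add, map_add,
        LinearMap.add_apply, map_add, ih fun y hy => h1 y (List.mem_cons_of_mem _ hy)]
      congr 1
      rw [map_smul, smul_mul_assoc, map_smul, h1 x List.mem_cons_self, map_smul, ← smul_neg,
        map_smul, LinearMap.smul_apply, map_smul]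

end GluingSplit

end FermiAlgebra

/-! ### The composition identity -/

namespace FermionicTheory

open KreinSpace

variable {𝒮 : SpacetimeSystem} (T : FermionicTheory 𝒮)

section Inclusions

variable {S : 𝒮.Hyp} {n : ℕ} {P : Fin n → 𝒮.Hyp} (d : 𝒮.Decomp S P)

/-- The inclusion of a component of a decomposition. -/
noncomputable def incl (i : Fin n) : T.L (P i) →ₗ[ℝ] T.L S :=
  (T.decL d).symm.toLinearEquiv.toLinearMap ∘ₗ
    (WithLp.linearEquiv 2 ℝ (∀ i, T.L (P i))).symm.toLinearMap ∘ₗ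
      LinearMap.single ℝ (fun i => T.L (P i)) i

theorem decL_incl (i k : Fin n) (x : T.L (P i)) :
    T.decL d (T.incl d i x) k = Pi.single (M := fun i => T.L (P i)) i x k := by
  change T.decL d ((T.decL d).symm _) k = _
  rw [LinearIsometryEquiv.apply_symm_apply]
  rfl

theorem pr_incl_self (i : Fin n) (x : T.L (P i)) : T.pr d i (T.incl d i x) = x :=
  (T.decL_incl d i i x).trans (Pi.single_eq_same _ _)

theorem pr_incl_of_ne {i k : Fin n} (h : k ≠ i) (x : T.L (P i)) :
    T.pr d k (T.incl d i x) = 0 :=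
  (T.decL_incl d i k x).trans (Pi.single_eq_of_ne h _)

theorem ext_pr {v w : T.L S} (h : ∀ i, T.pr d i v = T.pr d i w) : v = w :=
  (T.decL d).injective (PiLp.ext h)

theorem inner_incl (i : Fin n) (x : T.L (P i)) (v : T.L S) :
    inner ℝ v (T.incl d i x) = (inner ℝ (T.pr d i v) x : ℝ) := by
  rw [← (T.decL d).inner_map_map, PiLp.inner_apply, Finset.sum_eq_single i]
  · rw [decL_incl, Pi.single_eq_same]; rfl
  · intro k _ hk
    rw [decL_incl, Pi.single_eq_of_ne hk, inner_zero_right]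
  · simp

theorem pr_sym (i : Fin n) (v : T.L S) : T.pr d i (sym v) = sym (T.pr d i v) := T.decL_sym d v i

theorem sym_incl (i : Fin n) (x : T.L (P i)) : sym (T.incl d i x) = T.incl d i (sym x) := by
  refine T.ext_pr d fun k => ?_
  rw [pr_sym]
  by_cases hk : k = i
  · subst hk
    rw [pr_incl_self, pr_incl_self]
  · rw [pr_incl_of_ne T d hk, pr_incl_of_ne T d hk, map_zero]

end Inclusions

variable {M M₁ : 𝒮.Reg} {S S' : 𝒮.Hyp} (d : 𝒮.Decomp (𝒮.bdry M) ![𝒮.bdry M₁, S, 𝒮.rev S'])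
  (c : 𝒮.Copy S S')

/-- The isometry between the spaces of a hypersurface and of the reversal of its copy. -/
noncomputable def flipL : T.L S ≃ₗᵢ[ℝ] T.L (𝒮.rev S') := (T.copyL c).trans (T.revL S')

theorem sym_flipL (x : T.L S) : sym (T.flipL c x) = -T.flipL c (sym x) := by
  change sym (T.revL S' (T.copyL c x)) = -T.revL S' (T.copyL c (sym x))
  rw [T.revL_sym, T.copyL_sym]

/-- The decomposition `L_{∂M} = L_{∂M₁} ⊕ L_S ⊕ L_{rev S'}`. -/
noncomputable def gluingSplit :
    FermiAlgebra.GluingSplit (T.L (𝒮.bdry M)) (T.L (𝒮.bdry M₁)) (T.L S) :=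
  let j₀ : T.L (𝒮.bdry M₁) →ₗ[ℝ] T.L (𝒮.bdry M) := T.incl d 0
  let j₁ : T.L S →ₗ[ℝ] T.L (𝒮.bdry M) := T.incl d 1
  let j₂ : T.L (𝒮.rev S') →ₗ[ℝ] T.L (𝒮.bdry M) := T.incl d 2
  let p₀ : T.L (𝒮.bdry M) →L[ℝ] T.L (𝒮.bdry M₁) := T.pr d 0
  let p₁ : T.L (𝒮.bdry M) →L[ℝ] T.L S := T.pr d 1
  let p₂ : T.L (𝒮.bdry M) →L[ℝ] T.L (𝒮.rev S') := T.pr d 2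
  have h00 : ∀ x, p₀ (j₀ x) = x := T.pr_incl_self d 0
  have h11 : ∀ x, p₁ (j₁ x) = x := T.pr_incl_self d 1
  have h22 : ∀ x, p₂ (j₂ x) = x := T.pr_incl_self d 2
  have h01 : ∀ x, p₀ (j₁ x) = 0 :=
    T.pr_incl_of_ne d (i := 1) (k := 0) (by decide)
  have h02 : ∀ x, p₀ (j₂ x) = 0 :=
    T.pr_incl_of_ne d (i := 2) (k := 0) (by decide)
  have h10 : ∀ x, p₁ (j₀ x) = 0 :=
    T.pr_incl_of_ne d (i := 0) (k := 1) (by decide)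
  have h12 : ∀ x, p₁ (j₂ x) = 0 :=
    T.pr_incl_of_ne d (i := 2) (k := 1) (by decide)
  have h20 : ∀ x, p₂ (j₀ x) = 0 :=
    T.pr_incl_of_ne d (i := 0) (k := 2) (by decide)
  have h21 : ∀ x, p₂ (j₁ x) = 0 :=
    T.pr_incl_of_ne d (i := 1) (k := 2) (by decide)
  { p₀ := p₀
    p₁ := p₁
    p₂ := (T.flipL c).symm.toContinuousLinearEquiv.toContinuousLinearMap.comp p₂
    j₀ := j₀
    j₁ := j₁
    j₂ := j₂ ∘ₗ (T.flipL c).toLinearEquiv.toLinearMap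
    adj₀ := T.inner_incl d 0
    adj₁ := T.inner_incl d 1
    adj₂ := fun x v => by
      have h := T.inner_incl d 2 (T.flipL c x) v
      refine h.trans ?_
      change inner ℝ (p₂ v) (T.flipL c x) = (inner ℝ ((T.flipL c).symm (p₂ v)) x : ℝ)
      rw [← (T.flipL c).inner_map_map, LinearIsometryEquiv.apply_symm_apply]
    p₀_add := fun x y z => by
      rw [map_add, map_add, h00, h01, LinearMap.comp_apply, h02, add_zero, add_zero]
    p₁_add := fun x y z => by
      rw [map_add, map_add, h10, h11, LinearMap.comp_apply, h12, zero_add, add_zero]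
    p₂_add := fun x y z => by
      have h : p₂ (j₀ x + j₁ y + j₂ (T.flipL c z)) = T.flipL c z := by
        rw [map_add, map_add, h20, h21, h22, zero_add, zero_add]
      exact (congrArg (T.flipL c).symm h).trans ((T.flipL c).symm_apply_apply z)
    sym₀ := T.sym_incl d 0
    sym₁ := T.sym_incl d 1
    sym₂ := fun x => by
      have h : sym (j₂ (T.flipL c x)) = j₂ (sym (T.flipL c x)) := T.sym_incl d 2 _
      refine h.trans ?_
      rw [sym_flipL, map_neg]
      rfl }

theorem tau_eq (σ : T.D (𝒮.bdry M₁)) (ξ ξ' : T.D S) :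
    T.tau d c σ ξ ξ' = (T.gluingSplit d c).tau σ ξ ξ' := rfl

/-- Boundary values of solutions on the glued region extend to boundary values of solutions on the
original one that agree on the two copies of the gluing hypersurface. -/
theorem exists_mem_range_r (hglue : 𝒮.Glue d c) :
    ∀ n ∈ LinearMap.range (T.r M₁), ∃ l, (T.gluingSplit d c).j₀ n + (T.gluingSplit d c).j₁ l +
      (T.gluingSplit d c).j₂ l ∈ LinearMap.range (T.r M) := by
  rintro _ ⟨x, rfl⟩
  obtain ⟨j, -, h1, h2⟩ := T.glue d c hglue
  refine ⟨T.pr d 1 (T.r M (j x)), j x, ?_⟩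
  have h3 := (h1 (j x)).1 ⟨x, rfl⟩
  have e0 : T.pr d 0 (T.r M (j x)) = T.r M₁ x := h2 x
  have e2 : T.pr d 2 (T.r M (j x)) = T.flipL c (T.pr d 1 (T.r M (j x))) := h3
  refine T.ext_pr d fun k => ?_
  fin_cases k
  · exact e0.trans ((T.gluingSplit d c).p₀_add _ _ _).symm
  · exact ((T.gluingSplit d c).p₁_add _ _ _).symm
  · have h := (T.gluingSplit d c).p₂_add (T.r M₁ x) (T.pr d 1 (T.r M (j x)))
      (T.pr d 1 (T.r M (j x)))
    exact e2.trans ((T.flipL c).symm.injective (((T.flipL c).symm_apply_apply _).trans h.symm))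

end FermionicTheory

namespace FermionicTheory

open FermiAlgebra ExteriorAlgebra KreinSpace

variable {𝒮 : SpacetimeSystem} (T : FermionicTheory 𝒮) {M M₁ : 𝒮.Reg} {S S' : 𝒮.Hyp}
  (d : 𝒮.Decomp (𝒮.bdry M) ![𝒮.bdry M₁, S, 𝒮.rev S']) (c : 𝒮.Copy S S')

/-- `hasSum_glue` in terms of the theory. -/
theorem hasSum_glueTerm (s : ExteriorAlgebra ℝ (T.L (𝒮.bdry M₁))) (γ : FinKrein (T.L S))
    {ι : Type*} {ξ : ι → T.D S} (hξ : IsONBasis ξ) :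
    HasSum (fun i => T.glueTerm d c (toFock s) γ (ξ i))
      (gauss _ (inner_reversal_sym_self (T.range_r M)) (map (T.gluingSplit d c).j₀ s *
        copairing ((T.gluingSplit d c).j₁.comp sym.toLinearMap) (T.gluingSplit d c).j₂
          (frame γ))) :=
  (T.gluingSplit d c).hasSum_glue (T.u M) (inner_reversal_left (T.range_r M))
    (inner_reversal_sym_self (T.range_r M)) s γ hξ

theorem one_eq_toFock {V : Type*} [NormedAddCommGroup V] [InnerProductSpace ℝ V] [KreinSpace V] :
    (Fock.one : Fock V) = toFock 1 :=
  Fock.seq_injective toForms_one.symm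

/-- The gluing anomaly factor is the Gaussian functional of the copairing element. -/
theorem cHat_eq (γ : FinKrein (T.L S)) :
    T.cHat d c γ = gauss _ (inner_reversal_sym_self (T.range_r M))
      (copairing ((T.gluingSplit d c).j₁.comp sym.toLinearMap) (T.gluingSplit d c).j₂
        (frame γ)) := by
  have h := (T.hasSum_glueTerm d c 1 γ (isONBasis_onBasis (T.D S))).tsum_eq
  rw [← one_eq_toFock] at h
  refine h.trans (congrArg _ ?_)
  rw [map_one (map _), one_mul]

theorem hasSum_cHat (γ : FinKrein (T.L S)) {ι : Type*} {ξ : ι → T.D S} (hξ : IsONBasis ξ) :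
    HasSum (fun i => T.glueTerm d c Fock.one γ (ξ i)) (T.cHat d c γ) := by
  have h := T.hasSum_glueTerm d c 1 γ hξ
  rwa [map_one (map _), one_mul, ← cHat_eq, ← one_eq_toFock] at h

/-- The gluing identity in a truncation that is large enough for the given `σ`. -/
theorem exists_hasSum_glueTerm (hglue : 𝒮.Glue d c) (α₁ : FinKrein (T.L (𝒮.bdry M₁)))
    {σ : T.D (𝒮.bdry M₁)} (hσ : σ ∈ truncation α₁) :
    ∃ α : FinKrein (T.L S), ∀ γ ≥ α, ∀ (ι : Type*) (ξ : ι → T.D S), IsONBasis ξ →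
      HasSum (fun i => T.glueTerm d c σ γ (ξ i)) (T.A M₁ σ.seq * T.cHat d c γ) := by
  obtain ⟨w, rfl⟩ := exists_toFock_eq α₁ hσ
  obtain ⟨α, hα⟩ := (T.gluingSplit d c).exists_gauss_copairing_eq (T.range_r M) (T.range_r M₁)
    (T.exists_mem_range_r d c hglue) α₁
  refine ⟨α, fun γ hγ ι ξ hξ => ?_⟩
  have hA : T.A M₁ (toFock (map α₁.1.subtype w)).seq =
      gauss _ (inner_reversal_sym_self (T.range_r M₁)) (map α₁.1.subtype w) :=
    probMap_toForms (T.u M₁) (inner_reversal_left (T.range_r M₁)) _ _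
  rw [hA, cHat_eq, ← hα γ hγ w]
  exact T.hasSum_glueTerm d c _ γ hξ

theorem toForms_mem_domA (w : ExteriorAlgebra ℝ (T.L (𝒮.bdry M))) : toForms w ∈ T.domA M :=
  ⟨toForms_mem w, _, hasProb_toForms (T.u M) (inner_reversal_left (T.range_r M))
    (inner_reversal_sym_self (T.range_r M)) w⟩

end FermionicTheory

theorem mainTheorem1 {𝒮 : SpacetimeSystem} (T : FermionicTheory 𝒮) {M M₁ : 𝒮.Reg} {S S' : 𝒮.Hyp}
    (d : 𝒮.Decomp (𝒮.bdry M) ![𝒮.bdry M₁, S, 𝒮.rev S']) (c : 𝒮.Copy S S') (hglue : 𝒮.Glue d c) :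
    -- the gluing anomaly factor is well defined and does not depend on the ON-basis
    (∀ (γ : FinKrein (T.L S)) (ι : Type*) (ξ : ι → T.D S), IsONBasis ξ →
      HasSum (fun i => T.glueTerm d c Fock.one γ (ξ i)) (T.cHat d c γ)) ∧
    -- the composition identity in a truncation
    (∀ (α₁ : FinKrein (T.L (𝒮.bdry M₁))) (σ : T.D (𝒮.bdry M₁)), σ ∈ truncation α₁ →
      ∃ α : FinKrein (T.L S), ∀ γ ≥ α, ∀ (ι : Type*) (ξ : ι → T.D S), IsONBasis ξ →
        HasSum (fun i => T.glueTerm d c σ γ (ξ i)) (T.A M₁ σ.seq * T.cHat d c γ)) ∧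
    -- all probability maps involved are evaluated inside their domains
    (∀ σ ∈ truncated (T.L (𝒮.bdry M₁)), σ.seq ∈ T.domA M₁) ∧
    (∀ σ ∈ truncated (T.L (𝒮.bdry M₁)), ∀ ξ ∈ truncated (T.L S), ∀ ξ' ∈ truncated (T.L S),
      T.tau d c σ ξ ξ' ∈ T.domA M) ∧
    -- the elements `σ` considered form a dense subspace
    Dense (truncated (T.L (𝒮.bdry M₁)) : Set (T.D (𝒮.bdry M₁))) ∧
    -- the truncations are a direct system of finite dimensional Krein subspaces with limit `𝓓_S`
    (∀ γ : FinKrein (T.L S), FiniteDimensional ℝ (truncation γ) ∧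
      ∀ ξ ∈ truncation γ, KreinSpace.sym ξ ∈ truncation γ) ∧
    (∀ γ γ' : FinKrein (T.L S), γ ≤ γ' → truncation γ ≤ truncation γ') ∧
    Dense (truncated (T.L S) : Set (T.D S)) ∧
    -- the renormalized composition identity
    (∀ (ι : Type*) (ξ : ι → T.D S), IsONBasis ξ → ∀ σ ∈ truncated (T.L (𝒮.bdry M₁)),
      (∀ γ, Summable fun i => T.glueTerm d c σ γ (ξ i)) ∧
      IsDirectLimit
        (fun γ => T.A M₁ σ.seq * T.cHat d c γ - ∑' i, T.glueTerm d c σ γ (ξ i)) 0) := by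
  refine ⟨fun γ ι ξ hξ => T.hasSum_cHat d c γ hξ,
    fun α₁ σ hσ => T.exists_hasSum_glueTerm d c hglue α₁ hσ, ?_, ?_,
    FermiAlgebra.dense_truncated, fun γ => ⟨FermiAlgebra.finiteDimensional_truncation γ,
      fun ξ hξ => FermiAlgebra.sym_mem_truncation γ hξ⟩, fun γ γ' h => truncation_mono h,
    FermiAlgebra.dense_truncated, fun ι ξ hξ σ hσ => ⟨fun γ => ?_, ?_⟩⟩
  · rintro σ ⟨α₁, hσ⟩
    obtain ⟨w, rfl⟩ := FermiAlgebra.exists_toFock_eq α₁ hσ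
    exact T.toForms_mem_domA _
  · rintro σ ⟨α₁, hσ⟩ ξ ⟨α, hξ⟩ ξ' ⟨α', hξ'⟩
    obtain ⟨s, rfl⟩ := FermiAlgebra.exists_toFock_eq α₁ hσ
    obtain ⟨a, rfl⟩ := FermiAlgebra.exists_toFock_eq α hξ
    obtain ⟨b, rfl⟩ := FermiAlgebra.exists_toFock_eq α' hξ'
    rw [T.tau_eq, FermiAlgebra.GluingSplit.tau_toFock]
    exact T.toForms_mem_domA _
  · obtain ⟨α₁, hσ⟩ := hσ
    obtain ⟨w, rfl⟩ := FermiAlgebra.exists_toFock_eq α₁ hσ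
    exact (T.hasSum_glueTerm d c _ γ hξ).summable
  · obtain ⟨α₁, hσ⟩ := hσ
    obtain ⟨α, hα⟩ := T.exists_hasSum_glueTerm d c hglue α₁ hσ
    refine fun ε hε => ⟨α, fun γ hγ => ?_⟩
    beta_reduce
    rw [(hα γ hγ ι ξ hξ).tsum_eq, sub_self, sub_zero, abs_zero]
    exact hε
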